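/- Let $R$ be a commutative unital ring. A filtered chain complex is a cohomologically graded chain complex $A$ of $R$-modules, unbounded, with subcomplexes $F_pA\subseteq F_{p+1}A\subseteq A$ for $p\in\mathbb Z$ (no exhaustiveness or separatedness is assumed); morphisms are the chain maps $f$ with $f(F_pA)\subseteq F_pB$. Write $f\mathcal C$ for the resulting category. For $r\ge 0$ and $p,n\in\mathbb Z$ put $$Z_r^{p,p+n}(A)=F_pA^n\cap d^{-1}(F_{p-r}A^{n+1}),\qquad B_0^{p,p+n}(A)=F_{p-1}A^n,$$ $$B_r^{p,p+n}(A)=dZ_{r-1}^{p+r-1,\,p+r-1+(n-1)}(A)+Z_{r-1}^{p-1,\,p-1+n}(A)\quad(r\ge 1),\qquad E_r^{p,p+n}(A)=Z_r^{p,p+n}(A)/B_r^{p,p+n}(A).$$ A morphism $f$ is an $r$-quasi-isomorphism if $E_{r+1}^{p,p+n}(f)$ is an isomorphism for all $p,n$, and it is bidegreewise surjective on $s$-cycles if $Z_s^{p,p+n}(f)$ is surjective for all $p,n$. Let $R_{(p)}^n$ be a copy of $R$ in cohomological degree $n$ and pure filtration degree $p$ (so $F_q$ is $R$ for $q\ge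 p$ and $0$ for $q<p$). Let $\mathcal Z_r(p,n)=(R_{(p)}^n\to R_{(p-r)}^{n+1})$ with identity differential, and for $r\geq 1$ let $$\mathcal B_r(p,n)=(R_{(p+r-1)}^{n-1}\to R_{(p)}^n)\oplus(R_{(p-1)}^n\to R_{(p-r)}^{n+1}).$$ Let $\phi_r\colon\mathcal Z_r(p,n)\to\mathcal B_r(p,n)$ be the morphism that is the diagonal in degree $n$ and the identity onto $R_{(p-r)}^{n+1}$ in degree $n+1$. For $S\subseteq\{0,\dots,r\}$ containing $r$ set $$J_s=\{0\to\mathcal Z_s(p,n)\}_{p,n\in\mathbb Z},\quad J_S=\bigcup_{s\in S}J_s,\quad I_r=\{\phi_{r+1}\colon\mathcal Z_{r+1}(p,n)\to\mathcal B_{r+1}(p,n)\}_{p,n\in\mathbb Z},\quad I_S=I_r\cup J_S.$$ **Theorem.** For every $r\ge 0$ and every $S\subseteq\{0,\dots,r\}$ with $r\in S$, the category $f\mathcal C$ is complete and cocomplete and admits a model structure with functorial factorizations such that: 1. the weak equivalences are the $r$-quasi-isomorphisms; 2. the fibrations are the morphisms that are bidegreewise surjective on $s$-cycles for all $s\in S$;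 3. it is right proper: pullbacks of weak equivalences along fibrations are weak equivalences; 4. it is cofibrantly generated, with $I_S$ and $J_S$ as sets of generating cofibrations and generating acyclic cofibrations: the domains of $I_S$ (resp. $J_S$) are small relative to $I_S$-cell (resp. $J_S$-cell), where $K$-cell denotes the class of transfinite compositions of pushouts of elements of $K$; the fibrations are the morphisms with the right lifting property with respect to $J_S$; and the acyclic fibrations are those with the right lifting property with respect to $I_S$; 5. it is finitely cofibrantly generated: the domains and codomains of all elements of $I_S$ and $J_S$ are finite relative to the cofibrations. Here, for a cardinal $\kappa$ and a class $D$ of morphisms, an object $A$ is $\kappa$-small relative to $D$ if, for every $\kappa$-filtered ordinal $\lambda$ (a limit ordinal all of whose subsets of cardinality at most $\kappa$ have supremum less than $\lambda$) and every colimit-preserving functor $X\colon\lambda\to f\mathcal C$ with all maps $X_\beta\to X_{\beta+1}$ in $D$, the map $\operatorname{colim}_{\beta<\lambda}\operatorname{Hom}(A,X_\beta)\to\operatorname{Hom}(A,\operatorname{colim}_{\beta<\lambda}X_\beta)$ is a bijection. The object $A$ is small (resp. finite) relative to $D$ if this holds for some cardinal (resp. some finite cardinal) $\kappa$. -/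

import Mathlib

universe w v u

open CategoryTheory

/-! ### Filtered chain complexes -/

/-- A filtered chain complex over `R`: a cohomologically graded chain complex `A` of `R`-modules
with subcomplexes `F_p A ⊆ F_{p+1} A ⊆ A`, `p ∈ ℤ`. The filtration is not assumed to be
exhaustive, separated or bounded. -/
structure FilteredComplex (R : Type u) [CommRing R] where
  /-- the underlying cochain complex -/
  cx : CochainComplex (ModuleCat.{u} R) ℤ
  /-- `F p n` is the submodule `F_p A^n` of `A^n` -/
  F : ℤ → ∀ n : ℤ, Submodule R (cx.X n)
  F_mono : ∀ p n, F p n ≤ F (p + 1) n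
  F_d : ∀ (p i j : ℤ) (x : cx.X i), x ∈ F p i → (cx.d i j).hom x ∈ F p j

namespace FilteredComplex

variable {R : Type u} [CommRing R]

/-- Morphisms of filtered chain complexes: chain maps with `f (F_p A) ⊆ F_p B`. -/
@[ext]
structure Hom (A B : FilteredComplex R) where
  /-- the underlying chain map -/
  f : A.cx ⟶ B.cx
  map_F : ∀ (p n : ℤ) (x : A.cx.X n), x ∈ A.F p n → (f.f n).hom x ∈ B.F p n

/-- The category of filtered chain complexes. -/
instance : Category.{u} (FilteredComplex R) where
  Hom A B := Hom A B
  id A := { f := 𝟙 A.cx, map_F := fun _ _ _ hx => hx }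
  comp a b :=
    { f := a.f ≫ b.f
      map_F := fun p n x hx => b.map_F p n _ (a.map_F p n x hx) }

theorem F_le_of_le (A : FilteredComplex R) {p q : ℤ} (h : p ≤ q) (n : ℤ) : A.F p n ≤ A.F q n :=
  monotone_int_of_le_succ (f := fun p => A.F p n) (fun p => A.F_mono p n) h

/-! ### Cycles, boundaries, and the pages of the associated spectral sequence -/

/-- The `r`-cycles `Z_r^{p,p+n}(A) = F_p A^n ∩ d⁻¹ (F_{p-r} A^{n+1})`. -/
def Z (A : FilteredComplex R) (r : ℕ) (p n : ℤ) : Submodule R (A.cx.X n) :=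
  A.F p n ⊓ (A.F (p - r) (n + 1)).comap (A.cx.d n (n + 1)).hom

/-- The `r`-boundaries `B_r^{p,p+n}(A)`: these are `F_{p-1} A^n` for `r = 0`, and
`d Z_{r-1}^{p+r-1,p+r-1+(n-1)}(A) + Z_{r-1}^{p-1,p-1+n}(A)` for `r ≥ 1`. -/
def B (A : FilteredComplex R) : ℕ → ∀ (_p n : ℤ), Submodule R (A.cx.X n)
  | 0, p, n => A.F (p - 1) n
  | r + 1, p, n => (A.Z r (p + r) (n - 1)).map (A.cx.d (n - 1) n).hom ⊔ A.Z r (p - 1) n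

theorem B_le_Z (A : FilteredComplex R) (r : ℕ) (p n : ℤ) : A.B r p n ≤ A.Z r p n := by
  cases r with
  | zero =>
    intro x hx
    have hx' : x ∈ A.F p n := A.F_le_of_le (by omega) n hx
    refine ⟨hx', ?_⟩
    simpa using A.F_d p n (n + 1) x hx'
  | succ r =>
    refine sup_le ?_ ?_
    · rintro _ ⟨y, hy, rfl⟩
      have hd : (A.cx.d (n - 1) n).hom y ∈ A.F p n := by
        have h := hy.2
        simp only [add_sub_cancel_right] at h
        have e : n - 1 + 1 = n := by omega
        rwa [e] at h
      refine ⟨hd, ?_⟩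
      have h0 : (A.cx.d n (n + 1)).hom ((A.cx.d (n - 1) n).hom y) = 0 := by
        rw [← LinearMap.comp_apply, ← ModuleCat.hom_comp, A.cx.d_comp_d]
        rfl
      change (A.cx.d n (n + 1)).hom ((A.cx.d (n - 1) n).hom y) ∈ A.F (p - (r + 1 : ℕ)) (n + 1)
      rw [h0]
      exact Submodule.zero_mem _
    · intro x hx
      refine ⟨A.F_le_of_le (by omega) n hx.1, ?_⟩
      exact A.F_le_of_le (by push_cast; omega) (n + 1) hx.2

/-- `E_r^{p,p+n}(A) = Z_r^{p,p+n}(A) / B_r^{p,p+n}(A)`. -/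
abbrev E (A : FilteredComplex R) (r : ℕ) (p n : ℤ) : Type u :=
  (A.Z r p n) ⧸ (A.B r p n).submoduleOf (A.Z r p n)

variable {A A' : FilteredComplex R}

theorem map_mem_Z (f : A ⟶ A') (r : ℕ) (p n : ℤ) (x : A.cx.X n) (hx : x ∈ A.Z r p n) :
    (f.f.f n).hom x ∈ A'.Z r p n := by
  refine ⟨f.map_F p n x hx.1, ?_⟩
  have h := f.map_F (p - r) (n + 1) _ hx.2
  rw [← LinearMap.comp_apply, ← ModuleCat.hom_comp, ← f.f.comm, ModuleCat.hom_comp] at h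
  exact h

theorem map_mem_B (f : A ⟶ A') (r : ℕ) (p n : ℤ) (x : A.cx.X n) (hx : x ∈ A.B r p n) :
    (f.f.f n).hom x ∈ A'.B r p n := by
  cases r with
  | zero => exact f.map_F (p - 1) n x hx
  | succ r =>
    obtain ⟨_, ⟨y, hy, rfl⟩, z, hz, rfl⟩ := Submodule.mem_sup.1 hx
    rw [map_add]
    refine Submodule.add_mem_sup ⟨_, map_mem_Z f r _ _ y hy, ?_⟩ (map_mem_Z f r _ _ z hz)
    rw [← LinearMap.comp_apply, ← ModuleCat.hom_comp, f.f.comm, ModuleCat.hom_comp]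
    rfl

/-- The map `Z_r^{p,p+n}(f)` induced on `r`-cycles. -/
def mapZ (f : A ⟶ A') (r : ℕ) (p n : ℤ) : A.Z r p n →ₗ[R] A'.Z r p n :=
  (f.f.f n).hom.restrict (map_mem_Z f r p n)

/-- The map `E_r^{p,p+n}(f)` induced on the `r`-page. -/
def mapE (f : A ⟶ A') (r : ℕ) (p n : ℤ) : A.E r p n →ₗ[R] A'.E r p n :=
  Submodule.mapQ _ _ (mapZ f r p n) (fun x hx => map_mem_B f r p n x.1 hx)

variable (R)

/-- The class of `r`-quasi-isomorphisms: the morphisms inducing an isomorphism between the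
`(r+1)`-pages. -/
def quasiIsos (r : ℕ) : MorphismProperty (FilteredComplex R) :=
  fun _ _ f => ∀ p n : ℤ, Function.Bijective (mapE f (r + 1) p n)

/-- The class of morphisms that are bidegreewise surjective on `s`-cycles for all `s ∈ S`. -/
def cycleSurjections (S : Set ℕ) : MorphismProperty (FilteredComplex R) :=
  fun _ _ f => ∀ s ∈ S, ∀ p n : ℤ, Function.Surjective (mapZ f s p n)

/-! ### The representing objects and the generating sets -/

/-- The whole module if `P` holds, and zero otherwise. -/
noncomputable def gate {M : Type u} [AddCommGroup M] [Module R M] (P : Prop) : Submodule R M :=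
  open Classical in if P then ⊤ else ⊥

variable {R} in
theorem mem_gate {M : Type u} [AddCommGroup M] [Module R M] {P : Prop} {x : M} :
    x ∈ gate R P ↔ (¬ P → x = 0) := by
  unfold gate
  split_ifs with h <;> simp [h]

variable {R} in
/-- The map between submodules of the form `gate R P` that is `x ↦ x` if `c` holds, and zero
otherwise. -/
noncomputable def gateMap {M : Type u} [AddCommGroup M] [Module R M] {P Q : Prop} (c : Prop)
    (hc : c → Q) : (gate R P : Submodule R M) →ₗ[R] (gate R Q : Submodule R M) :=
  open Classical in
  if h : c then Submodule.inclusion (fun _ _ => mem_gate.2 (fun h' => absurd (hc h) h')) else 0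

variable {R} in
theorem gateMap_of_not {M : Type u} [AddCommGroup M] [Module R M] {P Q c : Prop}
    (hc : c → Q) (h : ¬ c) (x : (gate R P : Submodule R M)) : gateMap c hc x = 0 := by
  unfold gateMap
  rw [dif_neg h]
  rfl

variable {R} in
theorem gateMap_gateMap {M : Type u} [AddCommGroup M] [Module R M] {P Q Q' c c' : Prop}
    (hc : c → Q) (hc' : c' → Q') (h : ¬ (c ∧ c')) (x : (gate R P : Submodule R M)) :
    gateMap c' hc' (gateMap c hc x) = 0 := by
  by_cases h1 : c
  · exact gateMap_of_not hc' (fun h2 => h ⟨h1, h2⟩) _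
  · rw [gateMap_of_not hc h1, map_zero]

/-- The zero filtered chain complex. -/
def zeroObj : FilteredComplex R where
  cx :=
    { X := fun _ => ModuleCat.of R PUnit
      d := fun _ _ => 0 }
  F := fun _ _ => ⊤
  F_mono := fun _ _ => le_rfl
  F_d := fun _ _ _ _ _ => trivial

variable {R} in
/-- The morphism `0 ⟶ A`. -/
def fromZero (A : FilteredComplex R) : zeroObj R ⟶ A where
  f := { f := fun _ => 0 }
  map_F := fun _ _ _ _ => Submodule.zero_mem _

/-- `𝒵_r(p,n) = (R_{(p)}^n ⟶ R_{(p-r)}^{n+1})`: a copy of `R` in degree `n` and pure filtration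
degree `p`, a copy of `R` in degree `n + 1` and pure filtration degree `p - r`, and the identity
as differential between them. -/
noncomputable def repZ (r : ℕ) (p n : ℤ) : FilteredComplex R where
  cx :=
    { X := fun i => ModuleCat.of R (gate R (i = n ∨ i = n + 1) : Submodule R R)
      d := fun i j => ModuleCat.ofHom (gateMap (i = n ∧ j = n + 1) (fun h => Or.inr h.2))
      shape := by
        intro i j hij
        refine ModuleCat.hom_ext (LinearMap.ext fun x => ?_)
        refine gateMap_of_not (fun h => Or.inr h.2) ?_ x
        rintro ⟨rfl, rfl⟩
        exact hij rfl
      d_comp_d' := by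
        intro i j k _ _
        refine ModuleCat.hom_ext (LinearMap.ext fun x => ?_)
        exact gateMap_gateMap (fun h => Or.inr h.2) (fun h => Or.inr h.2) (by omega) x }
  F := fun q i => gate R ((i = n ∧ p ≤ q) ∨ (i = n + 1 ∧ p - r ≤ q))
  F_mono := by
    intro q i x hx
    rw [mem_gate] at hx ⊢
    exact fun h => hx (by omega)
  F_d := by
    intro q i j x hx
    rw [mem_gate] at hx ⊢
    intro h
    by_cases hij : i = n ∧ j = n + 1
    · rw [hx (by omega), map_zero]
    · exact gateMap_of_not (fun h => Or.inr h.2) hij x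

variable {R} in
/-- The direct sum of two filtered chain complexes. -/
def sum (A A' : FilteredComplex R) : FilteredComplex R where
  cx :=
    { X := fun i => ModuleCat.of R (A.cx.X i × A'.cx.X i)
      d := fun i j => ModuleCat.ofHom ((A.cx.d i j).hom.prodMap (A'.cx.d i j).hom)
      shape := by
        intro i j hij
        rw [A.cx.shape i j hij, A'.cx.shape i j hij]
        ext x <;> rfl
      d_comp_d' := by
        intro i j k _ _
        rw [← ModuleCat.ofHom_comp, LinearMap.prodMap_comp, ← ModuleCat.hom_comp,
          ← ModuleCat.hom_comp, A.cx.d_comp_d, A'.cx.d_comp_d]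
        ext x <;> rfl }
  F := fun p i => (A.F p i).prod (A'.F p i)
  F_mono := fun p n => Submodule.prod_mono (A.F_mono p n) (A'.F_mono p n)
  F_d := fun p i j x hx => ⟨A.F_d p i j x.1 hx.1, A'.F_d p i j x.2 hx.2⟩

/-- `ℬ_{r+1}(p,n) =
(R_{(p+r)}^{n-1} ⟶ R_{(p)}^n) ⊕ (R_{(p-1)}^n ⟶ R_{(p-r-1)}^{n+1})`. -/
noncomputable def repB (r : ℕ) (p n : ℤ) : FilteredComplex R :=
  (repZ R r (p + r) (n - 1)).sum (repZ R r (p - 1) n)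

/-- The morphism `φ_{r+1} : 𝒵_{r+1}(p,n) ⟶ ℬ_{r+1}(p,n)`, which is the diagonal `x ↦ (x, x)` in
degree `n` and the identity `x ↦ (0, x)` in degree `n + 1`. -/
noncomputable def phi (r : ℕ) (p n : ℤ) : repZ R (r + 1) p n ⟶ repB R r p n where
  f :=
    { f := fun i => ModuleCat.ofHom (LinearMap.prod
        (gateMap (i = n) (fun h => Or.inr (by omega))) LinearMap.id)
      comm' := by
        intro i j hij
        have hij' : i + 1 = j := hij
        ext x
        refine Prod.ext ?_ rfl
        exact (gateMap_gateMap _ (fun h => Or.inr h.2) (by omega) x).trans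
          (gateMap_gateMap (fun h => Or.inr h.2) _ (by omega) x).symm }
  map_F := by
    intro q i x hx
    have hx' := mem_gate.1 hx
    refine ⟨mem_gate.2 fun h => ?_, mem_gate.2 fun h => hx' (by push_cast; omega)⟩
    by_cases hi : i = n
    · rw [hx' (by push_cast; omega), map_zero]
      rfl
    · exact gateMap_of_not _ hi x

/-- `J_s = {0 ⟶ 𝒵_s(p,n)}` with `p, n ∈ ℤ`. -/
def genJ (s : ℕ) : MorphismProperty (FilteredComplex R) :=
  MorphismProperty.ofHoms (fun a : ℤ × ℤ => fromZero (repZ R s a.1 a.2))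

/-- `I_r = {φ_{r+1} : 𝒵_{r+1}(p,n) ⟶ ℬ_{r+1}(p,n)}` with `p, n ∈ ℤ`. -/
def genI (r : ℕ) : MorphismProperty (FilteredComplex R) :=
  MorphismProperty.ofHoms (fun a : ℤ × ℤ => phi R r a.1 a.2)

/-- `J_S`, the union of the `J_s` for `s ∈ S`. -/
def genJS (S : Set ℕ) : MorphismProperty (FilteredComplex R) :=
  ⨆ s ∈ S, genJ R s

/-- `I_S = I_r ∪ ⋃_{s ∈ S} J_s`, where `r = max S`. -/
def genIS (r : ℕ) (S : Set ℕ) : MorphismProperty (FilteredComplex R) :=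
  genI R r ⊔ ⨆ s ∈ S, genJ R s

end FilteredComplex

/-! ### Model categories -/

namespace ModelCat

open Limits HomotopicalAlgebra

section Smallness

variable {C : Type u} [Category.{v} C]

/-- `A` is `κ`-small relative to `D`: for every `κ`-filtered (limit) ordinal `λ`, given here as a
well-ordered type `J`, and every colimit-preserving functor `X : λ ⥤ C` all of whose maps
`X_β ⟶ X_{β+1}` are in `D`, the functor `C(A, -)` preserves the colimit of `X`. -/
def IsSmallAt (κ : Cardinal.{w}) (D : MorphismProperty C) (A : C) : Prop :=
  ∀ (J : Type w) [LinearOrder J] [SuccOrder J] [OrderBot J] [WellFoundedLT J] [NoMaxOrder J],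
    (∀ s : Set J, Cardinal.mk s ≤ κ → BddAbove s) →
    ∀ (X : J ⥤ C) [X.IsWellOrderContinuous],
      (∀ j : J, D (X.map (homOfLE (Order.le_succ j)))) →
        PreservesColimit X (coyoneda.obj (Opposite.op A))

/-- `A` is small relative to `D`. -/
def IsSmallRel (D : MorphismProperty C) (A : C) : Prop :=
  ∃ κ : Cardinal.{w}, IsSmallAt κ D A

/-- `A` is finite relative to `D`: it is `κ`-small relative to `D` for a finite cardinal `κ`. -/
def IsFiniteRel (D : MorphismProperty C) (A : C) : Prop :=
  ∃ k : ℕ, IsSmallAt (k : Cardinal.{w}) D A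

/-- `I`-cell: the transfinite compositions of pushouts of elements of `I`. -/
def cell (I : MorphismProperty C) : MorphismProperty C :=
  MorphismProperty.transfiniteCompositions.{w} I.pushouts

end Smallness

variable (C : Type u) [Category.{v} C]

/-- The parts of the definition of a model category that are stronger than in Mathlib's
`ModelCategory`: all small limits and colimits, and functorial factorizations. -/
structure IsCompleteFunctorial [ModelCategory C] : Prop where
  hasLimits : HasLimits C
  hasColimits : HasColimits C
  factorization₁ :
    MorphismProperty.HasFunctorialFactorization (trivialCofibrations C) (fibrations C)
  factorization₂ :
    MorphismProperty.HasFunctorialFactorization (cofibrations C) (trivialFibrations C)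

/-- Pullbacks of weak equivalences along fibrations are weak equivalences. -/
def IsRightProper [ModelCategory C] : Prop :=
  ∀ ⦃P X Y Z : C⦄ (a : P ⟶ X) (b : P ⟶ Y) (f : X ⟶ Z) (g : Y ⟶ Z), IsPullback a b f g →
    weakEquivalences C f → fibrations C g → weakEquivalences C b

variable {C}

/-- The model category `C` is cofibrantly generated, with `I` and `J` as sets of generating
cofibrations and generating acyclic cofibrations. -/
structure IsCofibrantlyGenerated [ModelCategory C] (I J : MorphismProperty C) : Prop where
  isSmall_I : MorphismProperty.IsSmall.{v} I
  isSmall_J : MorphismProperty.IsSmall.{v} J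
  small_I : ∀ ⦃A B : C⦄ (i : A ⟶ B), I i → IsSmallRel.{v} (cell.{v} I) A
  small_J : ∀ ⦃A B : C⦄ (j : A ⟶ B), J j → IsSmallRel.{v} (cell.{v} J) A
  fibrations_eq : fibrations C = J.rlp
  trivialFibrations_eq : trivialFibrations C = I.rlp

/-- The model category `C` is finitely cofibrantly generated by `I` and `J`: it is cofibrantly
generated by them, and the domains and codomains of `I` and `J` are finite relative to the
cofibrations. -/
structure IsFinitelyCofibrantlyGenerated [ModelCategory C] (I J : MorphismProperty C) : Prop
    extends IsCofibrantlyGenerated I J where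
  finite_I : ∀ ⦃A B : C⦄ (i : A ⟶ B), I i →
    IsFiniteRel.{v} (cofibrations C) A ∧ IsFiniteRel.{v} (cofibrations C) B
  finite_J : ∀ ⦃A B : C⦄ (j : A ⟶ B), J j →
    IsFiniteRel.{v} (cofibrations C) A ∧ IsFiniteRel.{v} (cofibrations C) B

end ModelCat

/-! The object 𝒵_s(p,n) represents the functor Z_s^{p,p+n} (`ofZ`, `repZ_hom_ext`). A morphism
ℬ_{r+1}(p,n) ⟶ A is a pair of r-cycles (y, z), and composing it with φ_{r+1} yields the (r+1)-cycle
dy + z (`phi_comp_app_gen`). All lifting problems thus become statements about elements: lifting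
against J_S is surjectivity on s-cycles, and lifting against φ_{r+1} is `BoundaryLifting`.

Acyclic fibrations (`genIS_rlp`): boundary lifting gives injectivity on E_{r+1} directly, and
surjectivity when applied to x = 0 = dy + (-dy). Conversely, if f is surjective on r-cycles and
bijective on E_{r+1}, it is surjective on (r+1)-cycles, and this lets a wrong choice of lifts be
corrected by an (r+1)-cycle.

Acyclic cofibrations (`quasiIso_of_llp`, `llp_cycleSurjections`): every object is fibrant and has a
path object A ⊕ A ⊕ A[-1], with filtration shifted by r on the last summand. Its endpoint map is a
fibration because s ≤ r for all s ∈ S, and its two endpoint projections agree on E_{r+1}. So a map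
with the left lifting property against fibrations has an inverse on E_{r+1}. The retract argument
gives the rest.

In a filtered colimit, F_p is the union of the images of the F_p of the stages, so the generating
objects are finitely presented. This gives both the finiteness claims and the small object argument.
Right properness is a diagram chase, using that Z_s preserves pullbacks and that r ∈ S. -/

namespace FilteredComplex

open Limits

variable {R : Type u} [CommRing R]

/-- The component in degree `n` of a morphism of filtered complexes. -/
abbrev Hom.app {A B : FilteredComplex R} (f : A ⟶ B) (n : ℤ) : A.cx.X n →ₗ[R] B.cx.X n :=
  (f.f.f n).hom

/-- The differential `A^i → A^j`. -/
abbrev diff (A : FilteredComplex R) (i j : ℤ) : A.cx.X i →ₗ[R] A.cx.X j :=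
  (A.cx.d i j).hom

@[simp]
theorem diff_diff (A : FilteredComplex R) (i j k : ℤ) (x : A.cx.X i) :
    A.diff j k (A.diff i j x) = 0 := by
  rw [← LinearMap.comp_apply, ← ModuleCat.hom_comp, A.cx.d_comp_d]
  rfl

theorem app_diff {A B : FilteredComplex R} (f : A ⟶ B) (i j : ℤ) (x : A.cx.X i) :
    Hom.app f j (A.diff i j x) = B.diff i j (Hom.app f i x) := by
  simp only [Hom.app, diff, ← LinearMap.comp_apply, ← ModuleCat.hom_comp, f.f.comm]

theorem hom_ext {A B : FilteredComplex R} {f g : A ⟶ B}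
    (h : ∀ n (x : A.cx.X n), Hom.app f n x = Hom.app g n x) : f = g :=
  Hom.ext (HomologicalComplex.Hom.ext (funext fun n =>
    ModuleCat.hom_ext (LinearMap.ext (h n))))

theorem comp_app {A B C : FilteredComplex R} (f : A ⟶ B) (g : B ⟶ C) (n : ℤ) (x : A.cx.X n) :
    Hom.app (f ≫ g) n x = Hom.app g n (Hom.app f n x) := rfl

theorem app_eq_of_comp_eq {A B C D : FilteredComplex R} {f : A ⟶ B} {g : B ⟶ D} {f' : A ⟶ C}
    {g' : C ⟶ D} (h : f ≫ g = f' ≫ g') (n : ℤ) (x : A.cx.X n) :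
    Hom.app g n (Hom.app f n x) = Hom.app g' n (Hom.app f' n x) := by
  rw [← comp_app, h, comp_app]

variable (R) in
/-- The functor forgetting the filtration. -/
def forget : FilteredComplex R ⥤ CochainComplex (ModuleCat.{u} R) ℤ where
  obj A := A.cx
  map f := f.f

/-! ### Limits and colimits -/

theorem mem_iInf_comap {J : Type u} {M : Type u} [AddCommGroup M] [Module R M] {N : J → Type u}
    [∀ j, AddCommGroup (N j)] [∀ j, Module R (N j)] (P : ∀ j, Submodule R (N j))
    (f : ∀ j, M →ₗ[R] N j) (x : M) : x ∈ ⨅ j, (P j).comap (f j) ↔ ∀ j, f j x ∈ P j := by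
  simp

theorem mem_iSup_map {J : Type u} {M : Type u} [AddCommGroup M] [Module R M] {N : J → Type u}
    [∀ j, AddCommGroup (N j)] [∀ j, Module R (N j)] (P : ∀ j, Submodule R (N j))
    (f : ∀ j, N j →ₗ[R] M) {j : J} {x : N j} (hx : x ∈ P j) : f j x ∈ ⨆ j, (P j).map (f j) :=
  Submodule.mem_iSup_of_mem j ⟨x, hx, rfl⟩

/-- The largest filtration on a complex for which the maps `π j` respect the filtrations. -/
def initialFiltration {J : Type u} (X : CochainComplex (ModuleCat.{u} R) ℤ)
    (A : J → FilteredComplex R) (π : ∀ j, X ⟶ (A j).cx) : FilteredComplex R where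
  cx := X
  F p n := ⨅ j, ((A j).F p n).comap ((π j).f n).hom
  F_mono p n := iInf_mono fun j => Submodule.comap_mono ((A j).F_mono p n)
  F_d p i j x hx := by
    refine (Submodule.mem_iInf _).2 fun k => ?_
    have h : ((π k).f j).hom ((X.d i j).hom x) = ((A k).cx.d i j).hom (((π k).f i).hom x) := by
      simp only [← LinearMap.comp_apply, ← ModuleCat.hom_comp, (π k).comm]
    rw [Submodule.mem_comap, h]
    exact (A k).F_d p i j _ ((Submodule.mem_iInf _).1 hx k)

/-- The smallest filtration on a complex for which the maps `ι j` respect the filtrations. -/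
def finalFiltration {J : Type u} (X : CochainComplex (ModuleCat.{u} R) ℤ)
    (A : J → FilteredComplex R) (ι : ∀ j, (A j).cx ⟶ X) : FilteredComplex R where
  cx := X
  F p n := ⨆ j, ((A j).F p n).map ((ι j).f n).hom
  F_mono p n := iSup_mono fun j => Submodule.map_mono ((A j).F_mono p n)
  F_d p i j := by
    change _ ≤ (⨆ k, ((A k).F p j).map ((ι k).f j).hom).comap (X.d i j).hom
    refine iSup_le fun k => ?_
    rintro _ ⟨x, hx, rfl⟩
    have h : ((ι k).f j).hom (((A k).cx.d i j).hom x) = (X.d i j).hom (((ι k).f i).hom x) := by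
      simp only [← LinearMap.comp_apply, ← ModuleCat.hom_comp, (ι k).comm]
    exact Submodule.mem_iSup_of_mem k ⟨_, (A k).F_d p i j x hx, h⟩

/-- The structure morphisms of the initial filtration. -/
def initialFiltrationπ {J : Type u} (X : CochainComplex (ModuleCat.{u} R) ℤ)
    (A : J → FilteredComplex R) (π : ∀ j, X ⟶ (A j).cx) (j : J) :
    initialFiltration X A π ⟶ A j where
  f := π j
  map_F p n x hx := (mem_iInf_comap (fun j => (A j).F p n) (fun j => ((π j).f n).hom) x).1 hx j

/-- A chain map into a complex with the initial filtration is a morphism of filtered complexes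
if its composites with the structure maps are. -/
def initialFiltrationLift {J : Type u} {X : CochainComplex (ModuleCat.{u} R) ℤ}
    {A : J → FilteredComplex R} {π : ∀ j, X ⟶ (A j).cx} {B : FilteredComplex R} (f : B.cx ⟶ X)
    (g : ∀ j, B ⟶ A j) (h : ∀ j, f ≫ π j = (g j).f) : B ⟶ initialFiltration X A π where
  f := f
  map_F p n x hx := by
    refine (mem_iInf_comap (fun j => (A j).F p n) (fun j => ((π j).f n).hom) _).2 fun j => ?_
    have := (g j).map_F p n x hx
    rw [← h] at this
    exact this

/-- The structure morphisms of the final filtration. -/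
def finalFiltrationι {J : Type u} (X : CochainComplex (ModuleCat.{u} R) ℤ)
    (A : J → FilteredComplex R) (ι : ∀ j, (A j).cx ⟶ X) (j : J) :
    A j ⟶ finalFiltration X A ι where
  f := ι j
  map_F p n _ hx := mem_iSup_map (fun j => (A j).F p n) (fun j => ((ι j).f n).hom) hx

/-- A chain map from a complex with the final filtration is a morphism of filtered complexes
if its composites with the structure maps are. -/
def finalFiltrationDesc {J : Type u} {X : CochainComplex (ModuleCat.{u} R) ℤ}
    {A : J → FilteredComplex R} {ι : ∀ j, (A j).cx ⟶ X} {B : FilteredComplex R} (f : X ⟶ B.cx)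
    (g : ∀ j, A j ⟶ B) (h : ∀ j, ι j ≫ f = (g j).f) : finalFiltration X A ι ⟶ B where
  f := f
  map_F p n := by
    change (⨆ j, ((A j).F p n).map ((ι j).f n).hom) ≤ (B.F p n).comap (f.f n).hom
    refine iSup_le fun j => ?_
    rintro _ ⟨x, hx, rfl⟩
    have := (g j).map_F p n x hx
    rw [← h] at this
    exact this

section

variable {J : Type u} [SmallCategory J] (K : J ⥤ FilteredComplex R)

/-- The cone of filtered complexes with the initial filtration over a cone of complexes. -/
def limitCone (c : Cone (K ⋙ forget R)) : Cone K where
  pt := initialFiltration c.pt K.obj c.π.app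
  π :=
    { app j := initialFiltrationπ c.pt K.obj c.π.app j
      naturality _ _ g := Hom.ext (c.π.naturality g) }

/-- The cone with the initial filtration over a limit cone is a limit cone. -/
def isLimitLimitCone {c : Cone (K ⋙ forget R)} (hc : IsLimit c) : IsLimit (limitCone K c) where
  lift s := initialFiltrationLift (hc.lift ((forget R).mapCone s)) s.π.app
    (hc.fac ((forget R).mapCone s))
  fac s j := Hom.ext (hc.fac ((forget R).mapCone s) j)
  uniq s m hm := Hom.ext (hc.uniq ((forget R).mapCone s) m.f fun j => congrArg Hom.f (hm j))

/-- The cocone of filtered complexes with the final filtration under a cocone of complexes. -/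
def colimitCocone (c : Cocone (K ⋙ forget R)) : Cocone K where
  pt := finalFiltration c.pt K.obj c.ι.app
  ι :=
    { app j := finalFiltrationι c.pt K.obj c.ι.app j
      naturality _ _ g := Hom.ext (c.ι.naturality g) }

/-- The cocone with the final filtration under a colimit cocone is a colimit cocone. -/
def isColimitColimitCocone {c : Cocone (K ⋙ forget R)} (hc : IsColimit c) :
    IsColimit (colimitCocone K c) where
  desc s := finalFiltrationDesc (hc.desc ((forget R).mapCocone s)) s.ι.app
    (hc.fac ((forget R).mapCocone s))
  fac s j := Hom.ext (hc.fac ((forget R).mapCocone s) j)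
  uniq s m hm := Hom.ext (hc.uniq ((forget R).mapCocone s) m.f fun j => congrArg Hom.f (hm j))

end

instance : HasLimits (FilteredComplex R) where
  has_limits_of_shape _ _ :=
    { has_limit K := ⟨⟨_, isLimitLimitCone K (limit.isLimit _)⟩⟩ }

instance : HasColimits (FilteredComplex R) where
  has_colimits_of_shape _ _ :=
    { has_colimit K := ⟨⟨_, isColimitColimitCocone K (colimit.isColimit _)⟩⟩ }

/-! ### Filtered colimits -/

section

variable {J : Type u} [SmallCategory J] {K : J ⥤ FilteredComplex R}

/-- A colimit cocone of filtered complexes is a colimit cocone of complexes. -/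
noncomputable def isColimitForget {c : Cocone K} (hc : IsColimit c) :
    IsColimit ((forget R).mapCocone c) :=
  (colimit.isColimit (K ⋙ forget R)).ofIsoColimit
    ((Cocone.functoriality K (forget R)).mapIso
      ((isColimitColimitCocone K (colimit.isColimit (K ⋙ forget R))).uniqueUpToIso hc))

/-- The same complex with the final filtration is also a cocone; the comparison map from the colimit
is the identity on complexes, so it compares the two filtrations. -/
theorem F_le_iSup_of_isColimit {c : Cocone K} (hc : IsColimit c) (p n : ℤ) :
    c.pt.F p n ≤ ⨆ j, ((K.obj j).F p n).map (Hom.app (c.ι.app j) n) := by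
  intro x hx
  let t := colimitCocone K ((forget R).mapCocone c)
  have h := (hc.desc t).map_F p n x hx
  have e : (hc.desc t).f = 𝟙 _ :=
    (isColimitForget hc).hom_ext fun j =>
      (congrArg Hom.f (hc.fac t j)).trans (Category.comp_id _).symm
  rw [e] at h
  exact h

variable [IsFiltered J]

theorem exists_map_app_eq_of_isColimit {c : Cocone K} (hc : IsColimit c) (n : ℤ) {i j : J}
    (x : (K.obj i).cx.X n) (y : (K.obj j).cx.X n)
    (hxy : Hom.app (c.ι.app i) n x = Hom.app (c.ι.app j) n y) :
    ∃ (k : J) (f : i ⟶ k) (g : j ⟶ k), Hom.app (K.map f) n x = Hom.app (K.map g) n y := by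
  let G := forget R ⋙ HomologicalComplex.eval (ModuleCat.{u} R) (ComplexShape.up ℤ) n
  have h : IsColimit (G.mapCocone c) :=
    isColimitOfPreserves (HomologicalComplex.eval _ _ n) (isColimitForget hc)
  exact Concrete.isColimit_exists_of_rep_eq _ h x y hxy

theorem exists_mem_F_of_isColimit {c : Cocone K} (hc : IsColimit c) {p n : ℤ} {x : c.pt.cx.X n}
    (hx : x ∈ c.pt.F p n) : ∃ j, ∃ y ∈ (K.obj j).F p n, Hom.app (c.ι.app j) n y = x := by
  have hx' := F_le_iSup_of_isColimit hc p n hx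
  have := (IsFiltered.nonempty (C := J))
  refine (Submodule.mem_iSup_of_directed _ ?_).1 hx'
  have key : ∀ {a b : J} (f : a ⟶ b), ((K.obj a).F p n).map (Hom.app (c.ι.app a) n) ≤
      ((K.obj b).F p n).map (Hom.app (c.ι.app b) n) := by
    rintro a b f _ ⟨y, hy, rfl⟩
    refine ⟨_, (K.map f).map_F p n y hy, ?_⟩
    change Hom.app (c.ι.app b) n (Hom.app (K.map f) n y) = _
    rw [← comp_app, c.w]
  intro i j
  exact ⟨IsFiltered.max i j, key (IsFiltered.leftToMax i j), key (IsFiltered.rightToMax i j)⟩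

theorem exists_mem_Z_of_isColimit {c : Cocone K} (hc : IsColimit c) {s : ℕ} {p n : ℤ}
    {x : c.pt.cx.X n} (hx : x ∈ c.pt.Z s p n) :
    ∃ j, ∃ y ∈ (K.obj j).Z s p n, Hom.app (c.ι.app j) n y = x := by
  obtain ⟨i, y, hy, rfl⟩ := exists_mem_F_of_isColimit hc hx.1
  obtain ⟨j, z, hz, hzy⟩ := exists_mem_F_of_isColimit hc hx.2
  -- The differential of `y` and the element `z` of F_{p-s} have the same image in the colimit, so
  -- they already agree at a later stage, where `y` becomes an s-cycle.
  obtain ⟨k, f, g, hfg⟩ := exists_map_app_eq_of_isColimit hc (n + 1) z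
    ((K.obj i).diff n (n + 1) y) (hzy.trans (app_diff (c.ι.app i) n (n + 1) y).symm)
  refine ⟨k, Hom.app (K.map g) n y, ⟨(K.map g).map_F p n y hy, ?_⟩, ?_⟩
  · change (K.obj k).diff n (n + 1) (Hom.app (K.map g) n y) ∈ (K.obj k).F (p - s) (n + 1)
    rw [← app_diff, ← hfg]
    exact (K.map f).map_F _ _ z hz
  · rw [← comp_app, c.w]

end

/-! ### The functors represented by the generating objects -/

theorem mem_Z {A : FilteredComplex R} {s : ℕ} {p n : ℤ} {x : A.cx.X n} :
    x ∈ A.Z s p n ↔ x ∈ A.F p n ∧ A.diff n (n + 1) x ∈ A.F (p - s) (n + 1) := Iff.rfl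

theorem gateMap_of_pos {M : Type u} [AddCommGroup M] [Module R M] {P Q c : Prop}
    (hc : c → Q) (h : c) (x : (gate R P : Submodule R M)) : (gateMap c hc x).1 = x.1 := by
  unfold gateMap
  rw [dif_pos h]
  rfl

variable (R) in
/-- The element of `𝒵_s(p,n)` in degree `i` given by a scalar. -/
noncomputable def repZElem (s : ℕ) (p : ℤ) {n i : ℤ} (hi : i = n ∨ i = n + 1) (a : R) :
    (repZ R s p n).cx.X i :=
  (⟨a, mem_gate.2 fun h => absurd hi h⟩ : (gate R (i = n ∨ i = n + 1) : Submodule R R))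

variable (R) in
/-- The universal `s`-cycle. -/
noncomputable def gen (s : ℕ) (p n : ℤ) : (repZ R s p n).cx.X n :=
  repZElem R s p (Or.inl rfl) 1

theorem repZ_diff_gen (s : ℕ) (p : ℤ) {n m : ℤ} (h : m = n + 1) :
    (repZ R s p n).diff n m (gen R s p n) = repZElem R s p (Or.inr h) 1 :=
  Subtype.ext (gateMap_of_pos (fun h => Or.inr h.2) ⟨rfl, h⟩ _)

theorem gen_mem_Z (s : ℕ) (p n : ℤ) : gen R s p n ∈ (repZ R s p n).Z s p n := by
  refine mem_Z.2 ⟨?_, ?_⟩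
  · exact mem_gate.2 fun h => absurd (Or.inl ⟨rfl, le_rfl⟩) h
  · rw [repZ_diff_gen s p rfl]
    exact mem_gate.2 fun h => absurd (Or.inr ⟨rfl, le_rfl⟩) h

/-- The generator in degree n + 1 is the differential of the universal cycle, so the value on the
latter determines everything. -/
theorem repZ_hom_ext {A : FilteredComplex R} {s : ℕ} {p n : ℤ} {f g : repZ R s p n ⟶ A}
    (h : Hom.app f n (gen R s p n) = Hom.app g n (gen R s p n)) : f = g := by
  refine hom_ext fun i x => ?_
  by_cases hi : i = n ∨ i = n + 1
  · have hx : x = x.1 • repZElem R s p hi 1 := Subtype.ext (mul_one x.1).symm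
    rw [hx, map_smul, map_smul]
    congr 1
    obtain rfl | rfl := hi
    · exact h
    · rw [← repZ_diff_gen s p rfl, app_diff, app_diff, h]
  · have hx : x = 0 := Subtype.ext (mem_gate.1 x.2 hi)
    rw [hx, map_zero, map_zero]

open Classical in
/-- The element `x` in degree `n`, its differential in degree `n + 1`, and zero otherwise. -/
noncomputable def spread (A : FilteredComplex R) {n : ℤ} (x : A.cx.X n) (i : ℤ) : A.cx.X i :=
  (if h : n = i then h ▸ x else 0) + A.diff n i x

theorem spread_self (A : FilteredComplex R) {n : ℤ} (x : A.cx.X n) : A.spread x n = x := by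
  simp [spread, diff]

theorem spread_succ (A : FilteredComplex R) {n : ℤ} (x : A.cx.X n) :
    A.spread x (n + 1) = A.diff n (n + 1) x := by
  simp [spread]

theorem diff_spread (A : FilteredComplex R) {n : ℤ} (x : A.cx.X n) {i j : ℤ} (h : i ≠ n) :
    A.diff i j (A.spread x i) = 0 := by
  simp [spread, h.symm]

/-- The morphism `𝒵_s(p,n) ⟶ A` classifying an `s`-cycle of `A`. -/
noncomputable def ofZ (A : FilteredComplex R) {s : ℕ} {p n : ℤ} (x : A.cx.X n)
    (hx : x ∈ A.Z s p n) : repZ R s p n ⟶ A where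
  f :=
    { f i := ModuleCat.ofHom
        ((LinearMap.toSpanSingleton R _ (A.spread x i)) ∘ₗ
          (gate R (i = n ∨ i = n + 1) : Submodule R R).subtype)
      comm' i j hij := by
        obtain rfl : i + 1 = j := hij
        refine ModuleCat.hom_ext (LinearMap.ext
          fun a : (gate R (i = n ∨ i = n + 1) : Submodule R R) => ?_)
        change A.diff i (i + 1) (a.1 • A.spread x i) =
          (gateMap (i = n ∧ i + 1 = n + 1) (fun h => Or.inr h.2) a).1 • A.spread x (i + 1)
        rw [map_smul]
        by_cases hi : i = n
        · subst hi
          rw [gateMap_of_pos (fun h => Or.inr h.2) ⟨rfl, rfl⟩ a, spread_self, spread_succ]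
        · rw [gateMap_of_not (fun h => Or.inr h.2) (fun h => hi h.1) a, diff_spread _ _ hi]
          simp }
  map_F q i a ha := by
    change a.1 • A.spread x i ∈ A.F q i
    rw [show a ∈ (repZ R s p n).F q i ↔ _ from mem_gate] at ha
    by_cases h : (i = n ∧ p ≤ q) ∨ (i = n + 1 ∧ p - s ≤ q)
    · refine Submodule.smul_mem _ _ ?_
      obtain ⟨rfl, h⟩ | ⟨rfl, h⟩ := h
      · rw [spread_self]
        exact A.F_le_of_le h _ hx.1
      · rw [spread_succ]
        exact A.F_le_of_le h _ hx.2
    · rw [ha h]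
      change (0 : R) • _ ∈ _
      simp

theorem ofZ_gen (A : FilteredComplex R) {s : ℕ} {p n : ℤ} (x : A.cx.X n)
    (hx : x ∈ A.Z s p n) : Hom.app (ofZ A x hx) n (gen R s p n) = x := by
  change (1 : R) • A.spread x n = x
  rw [spread_self, one_smul]

theorem app_gen_mem_Z {A : FilteredComplex R} {s : ℕ} {p n : ℤ} (f : repZ R s p n ⟶ A) :
    Hom.app f n (gen R s p n) ∈ A.Z s p n :=
  map_mem_Z f s p n _ (gen_mem_Z s p n)

/-- The inclusion of the first summand. -/
def sumInl (A A' : FilteredComplex R) : A ⟶ A.sum A' where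
  f :=
    { f i := ModuleCat.ofHom (LinearMap.inl R (A.cx.X i) (A'.cx.X i))
      comm' i j _ := by
        refine ModuleCat.hom_ext (LinearMap.ext fun a => ?_)
        exact Prod.ext rfl (map_zero (A'.diff i j)) }
  map_F _ _ _ hx := ⟨hx, Submodule.zero_mem _⟩

/-- The inclusion of the second summand. -/
def sumInr (A A' : FilteredComplex R) : A' ⟶ A.sum A' where
  f :=
    { f i := ModuleCat.ofHom (LinearMap.inr R (A.cx.X i) (A'.cx.X i))
      comm' i j _ := by
        refine ModuleCat.hom_ext (LinearMap.ext fun a => ?_)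
        exact Prod.ext (map_zero (A.diff i j)) rfl }
  map_F _ _ _ hx := ⟨Submodule.zero_mem _, hx⟩

/-- The morphism from a direct sum given by morphisms from both summands. -/
def sumDesc {A A' C : FilteredComplex R} (f : A ⟶ C) (g : A' ⟶ C) : A.sum A' ⟶ C where
  f :=
    { f i := ModuleCat.ofHom ((Hom.app f i).coprod (Hom.app g i))
      comm' i j _ := by
        refine ModuleCat.hom_ext (LinearMap.ext fun a => ?_)
        change C.diff i j (Hom.app f i a.1 + Hom.app g i a.2) =
          Hom.app f j (A.diff i j a.1) + Hom.app g j (A'.diff i j a.2)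
        rw [map_add, app_diff, app_diff] }
  map_F p n x hx := Submodule.add_mem _ (f.map_F p n _ hx.1) (g.map_F p n _ hx.2)

@[simp]
theorem sumInl_sumDesc {A A' C : FilteredComplex R} (f : A ⟶ C) (g : A' ⟶ C) :
    sumInl A A' ≫ sumDesc f g = f :=
  hom_ext fun n x => by
    change Hom.app f n x + Hom.app g n 0 = _
    rw [map_zero, add_zero]

@[simp]
theorem sumInr_sumDesc {A A' C : FilteredComplex R} (f : A ⟶ C) (g : A' ⟶ C) :
    sumInr A A' ≫ sumDesc f g = g :=
  hom_ext fun n x => by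
    change Hom.app f n 0 + Hom.app g n x = _
    rw [map_zero, zero_add]

theorem sum_hom_ext {A A' C : FilteredComplex R} {f g : A.sum A' ⟶ C}
    (h₁ : sumInl A A' ≫ f = sumInl A A' ≫ g) (h₂ : sumInr A A' ≫ f = sumInr A A' ≫ g) :
    f = g := by
  refine hom_ext fun n x => ?_
  have hx : x = Hom.app (sumInl A A') n x.1 + Hom.app (sumInr A A') n x.2 :=
    Prod.ext (add_zero _).symm (zero_add _).symm
  rw [hx, map_add, map_add, ← comp_app, ← comp_app, ← comp_app, ← comp_app, h₁, h₂]

theorem zeroObj_hom_ext {A : FilteredComplex R} (f g : zeroObj R ⟶ A) : f = g :=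
  hom_ext fun n x => by
    have hx : x = 0 := rfl
    rw [hx, map_zero, map_zero]

/-- The morphism `A ⟶ 0`. -/
def toZero (A : FilteredComplex R) : A ⟶ zeroObj R where
  f := { f := fun _ => 0 }
  map_F _ _ _ _ := trivial

/-! ### Finite presentability -/

/-- A filtered complex is finitely presented if morphisms from it to a filtered colimit factor
through some stage, in an essentially unique way. -/
def FinPres (A : FilteredComplex R) : Prop :=
  ∀ ⦃J : Type u⦄ [SmallCategory J] [IsFiltered J] ⦃K : J ⥤ FilteredComplex R⦄ ⦃c : Cocone K⦄
    (_ : IsColimit c), (∀ f : A ⟶ c.pt, ∃ j g, f = g ≫ c.ι.app j) ∧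
    ∀ (i : J) (f g : A ⟶ K.obj i), f ≫ c.ι.app i = g ≫ c.ι.app i →
      ∃ (k : J) (a : i ⟶ k), f ≫ K.map a = g ≫ K.map a

theorem FinPres.preservesColimit {A : FilteredComplex R} (hA : FinPres A) {J : Type u}
    [SmallCategory J] [IsFiltered J] (K : J ⥤ FilteredComplex R) :
    PreservesColimit K (coyoneda.obj (Opposite.op A)) where
  preserves {_} hc := ⟨Types.FilteredColimit.isColimitOf' _ _ (hA hc).1 (hA hc).2⟩

theorem finPres_repZ (s : ℕ) (p n : ℤ) : FinPres (repZ R s p n) := by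
  intro J _ _ K c hc
  refine ⟨fun f => ?_, fun i f g h => ?_⟩
  · obtain ⟨j, y, hy, hyf⟩ := exists_mem_Z_of_isColimit hc (app_gen_mem_Z f)
    refine ⟨j, ofZ _ y hy, repZ_hom_ext ?_⟩
    rw [comp_app, ofZ_gen, hyf]
  · obtain ⟨k, a, b, hab⟩ := exists_map_app_eq_of_isColimit hc n _ _
      (app_eq_of_comp_eq h n (gen R s p n))
    -- The two elements were pushed along possibly different arrows `a` and `b`; coequalizing these
    -- gives a single transition map.
    refine ⟨IsFiltered.coeq a b, a ≫ IsFiltered.coeqHom a b, repZ_hom_ext ?_⟩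
    have e : K.map (a ≫ IsFiltered.coeqHom a b) = K.map (b ≫ IsFiltered.coeqHom a b) := by
      rw [IsFiltered.coeq_condition]
    conv_rhs => rw [e]
    rw [K.map_comp, K.map_comp]
    simp only [comp_app, hab]

theorem FinPres.sum {A A' : FilteredComplex R} (hA : FinPres A) (hA' : FinPres A') :
    FinPres (A.sum A') := by
  intro J _ _ K c hc
  refine ⟨fun f => ?_, fun i f g h => ?_⟩
  · obtain ⟨i, g, hg⟩ := (hA hc).1 (sumInl A A' ≫ f)
    obtain ⟨j, g', hg'⟩ := (hA' hc).1 (sumInr A A' ≫ f)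
    refine ⟨IsFiltered.max i j, sumDesc (g ≫ K.map (IsFiltered.leftToMax i j))
      (g' ≫ K.map (IsFiltered.rightToMax i j)), sum_hom_ext ?_ ?_⟩
    · rw [← Category.assoc, sumInl_sumDesc, Category.assoc, c.w, hg]
    · rw [← Category.assoc, sumInr_sumDesc, Category.assoc, c.w, hg']
  · obtain ⟨j, a, ha⟩ := (hA hc).2 i (sumInl A A' ≫ f) (sumInl A A' ≫ g) (by
      rw [Category.assoc, Category.assoc, h])
    obtain ⟨k, b, hb⟩ := (hA' hc).2 i (sumInr A A' ≫ f) (sumInr A A' ≫ g) (by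
      rw [Category.assoc, Category.assoc, h])
    obtain ⟨l, a', b', hl⟩ := IsFiltered.span a b
    refine ⟨l, a ≫ a', sum_hom_ext ?_ ?_⟩
    · simp only [K.map_comp, ← Category.assoc] at ha ⊢
      rw [ha]
    · rw [hl]
      simp only [K.map_comp, ← Category.assoc] at hb ⊢
      rw [hb]

theorem finPres_zeroObj : FinPres (zeroObj R) := fun J _ _ _ _ _ =>
  ⟨fun _ => ⟨(IsFiltered.nonempty (C := J)).some, fromZero _, zeroObj_hom_ext _ _⟩,
    fun i _ _ _ => ⟨i, 𝟙 i, zeroObj_hom_ext _ _⟩⟩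

/-- A linear order with a least element is filtered, so neither `D` nor the size of κ matters, and κ
= 0 will do. -/
theorem FinPres.isFiniteRel {A : FilteredComplex R} (hA : FinPres A)
    (D : MorphismProperty (FilteredComplex R)) : ModelCat.IsFiniteRel.{u} D A :=
  ⟨0, fun _ _ _ _ _ _ _ _ _ _ => hA.preservesColimit _⟩

/-! ### Lifting properties -/

/-- A square from 0 ⟶ 𝒵_s(p,n) to f is an s-cycle of Y, and a lift is an s-cycle of X above it. -/
theorem genJ_rlp_iff {X Y : FilteredComplex R} (f : X ⟶ Y) (s : ℕ) :
    (genJ R s).rlp f ↔ ∀ p n, Function.Surjective (mapZ f s p n) := by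
  constructor
  · rintro h p n ⟨y, hy⟩
    have : HasLiftingProperty (fromZero (repZ R s p n)) f :=
      h _ (MorphismProperty.ofHoms.mk (p, n))
    have sq : CommSq (fromZero X) (fromZero (repZ R s p n)) f (ofZ Y y hy) :=
      ⟨zeroObj_hom_ext _ _⟩
    refine ⟨⟨Hom.app sq.lift n (gen R s p n), app_gen_mem_Z sq.lift⟩, Subtype.ext ?_⟩
    change Hom.app f n (Hom.app sq.lift n (gen R s p n)) = y
    rw [← comp_app, sq.fac_right, ofZ_gen]
  · rintro h _ _ _ ⟨p, n⟩
    refine ⟨fun {_ b} sq => ?_⟩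
    obtain ⟨⟨x, hx⟩, hxb⟩ := h p n ⟨_, app_gen_mem_Z b⟩
    refine ⟨⟨⟨ofZ _ x hx, zeroObj_hom_ext _ _, repZ_hom_ext ?_⟩⟩⟩
    rw [comp_app, ofZ_gen]
    exact congrArg Subtype.val hxb

/-- The inclusion of the first summand of `ℬ_{r+1}(p,n)`. -/
noncomputable def repBInl (r : ℕ) (p n : ℤ) : repZ R r (p + r) (n - 1) ⟶ repB R r p n :=
  sumInl _ _

/-- The inclusion of the second summand of `ℬ_{r+1}(p,n)`. -/
noncomputable def repBInr (r : ℕ) (p n : ℤ) : repZ R r (p - 1) n ⟶ repB R r p n :=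
  sumInr _ _

theorem exists_repB_desc {r : ℕ} {p n : ℤ} {A : FilteredComplex R}
    (f : repZ R r (p + r) (n - 1) ⟶ A) (g : repZ R r (p - 1) n ⟶ A) :
    ∃ h : repB R r p n ⟶ A, repBInl r p n ≫ h = f ∧ repBInr r p n ≫ h = g :=
  ⟨sumDesc f g, sumInl_sumDesc f g, sumInr_sumDesc f g⟩

theorem repB_hom_ext {r : ℕ} {p n : ℤ} {A : FilteredComplex R} {f g : repB R r p n ⟶ A}
    (h₁ : repBInl r p n ≫ f = repBInl r p n ≫ g) (h₂ : repBInr r p n ≫ f = repBInr r p n ≫ g) :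
    f = g :=
  sum_hom_ext h₁ h₂

/-- This is the universal case of the formula dy + z for elements of B_{r+1}. -/
theorem phi_app_gen (r : ℕ) (p n : ℤ) :
    Hom.app (phi R r p n) n (gen R (r + 1) p n) =
      (repB R r p n).diff (n - 1) n (Hom.app (repBInl r p n) (n - 1) (gen R r (p + r) (n - 1))) +
        Hom.app (repBInr r p n) n (gen R r (p - 1) n) := by
  rw [← app_diff, repZ_diff_gen _ _ (by omega)]
  refine Prod.ext ?_ ?_
  · refine Eq.trans ?_ (add_zero _).symm
    exact Subtype.ext (gateMap_of_pos _ rfl _)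
  · exact (zero_add _).symm

theorem phi_comp_app_gen {r : ℕ} {p n : ℤ} {A : FilteredComplex R} (b : repB R r p n ⟶ A) :
    Hom.app (phi R r p n ≫ b) n (gen R (r + 1) p n) =
      A.diff (n - 1) n (Hom.app (repBInl r p n ≫ b) (n - 1) (gen R r (p + r) (n - 1))) +
        Hom.app (repBInr r p n ≫ b) n (gen R r (p - 1) n) := by
  rw [comp_app, phi_app_gen, map_add, app_diff]
  rfl

/-- The lifting property against `φ_{r+1}` in terms of elements. -/
def BoundaryLifting {X Y : FilteredComplex R} (f : X ⟶ Y) (r : ℕ) : Prop :=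
  ∀ (p n : ℤ), ∀ x ∈ X.Z (r + 1) p n, ∀ y ∈ Y.Z r (p + r) (n - 1), ∀ z ∈ Y.Z r (p - 1) n,
    Hom.app f n x = Y.diff (n - 1) n y + z →
      ∃ v ∈ X.Z r (p + r) (n - 1), ∃ w ∈ X.Z r (p - 1) n,
        X.diff (n - 1) n v + w = x ∧ Hom.app f (n - 1) v = y ∧ Hom.app f n w = z

/-- By representability, a square from φ_{r+1} to f is a triple (x, y, z) with f x = dy + z, and a
lift is a pair (v, w) above (y, z) with dv + w = x. -/
theorem genI_rlp_iff {X Y : FilteredComplex R} (f : X ⟶ Y) (r : ℕ) :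
    (genI R r).rlp f ↔ BoundaryLifting f r := by
  constructor
  · intro h p n x hx y hy z hz hxyz
    have : HasLiftingProperty (phi R r p n) f := h _ (MorphismProperty.ofHoms.mk (p, n))
    obtain ⟨b, hb₁, hb₂⟩ := exists_repB_desc (ofZ Y y hy) (ofZ Y z hz)
    have sq : CommSq (ofZ X x hx) (phi R r p n) f b :=
      ⟨repZ_hom_ext (by
        rw [phi_comp_app_gen, hb₁, hb₂, comp_app, ofZ_gen, ofZ_gen, ofZ_gen, hxyz])⟩
    refine ⟨_, app_gen_mem_Z (repBInl r p n ≫ sq.lift), _,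
      app_gen_mem_Z (repBInr r p n ≫ sq.lift), ?_, ?_, ?_⟩
    · rw [← phi_comp_app_gen, sq.fac_left, ofZ_gen]
    · rw [← comp_app, Category.assoc, sq.fac_right, hb₁, ofZ_gen]
    · rw [← comp_app, Category.assoc, sq.fac_right, hb₂, ofZ_gen]
  · rintro h _ _ _ ⟨p, n⟩
    refine ⟨fun {a b} sq => ?_⟩
    obtain ⟨v, hv, w, hw, h₁, h₂, h₃⟩ := h p n _ (app_gen_mem_Z a) _
      (app_gen_mem_Z (repBInl r p n ≫ b)) _ (app_gen_mem_Z (repBInr r p n ≫ b))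
      (by rw [← comp_app, sq.w, phi_comp_app_gen])
    obtain ⟨l, hl₁, hl₂⟩ := exists_repB_desc (ofZ _ v hv) (ofZ _ w hw)
    refine ⟨⟨⟨l, repZ_hom_ext ?_, repB_hom_ext ?_ ?_⟩⟩⟩
    · rw [phi_comp_app_gen, hl₁, hl₂, ofZ_gen, ofZ_gen, h₁]
    · rw [← Category.assoc, hl₁]
      exact repZ_hom_ext (by rw [comp_app, ofZ_gen, h₂])
    · rw [← Category.assoc, hl₂]
      exact repZ_hom_ext (by rw [comp_app, ofZ_gen, h₃])

theorem rlp_sup {C : Type*} [Category* C] (W W' : MorphismProperty C) :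
    (W ⊔ W').rlp = W.rlp ⊓ W'.rlp :=
  MorphismProperty.gc_llp_rlp.u_inf (b₁ := OrderDual.toDual W) (b₂ := OrderDual.toDual W')

theorem genJS_rlp (S : Set ℕ) : (genJS R S).rlp = cycleSurjections R S := by
  ext X Y f
  have h : (genJS R S).rlp f ↔ ∀ s ∈ S, (genJ R s).rlp f := by
    constructor
    · intro h s hs _ _ g hg
      exact h g (le_iSup₂_of_le (f := fun s (_ : s ∈ S) => genJ R s) s hs le_rfl _ hg)
    · intro h _ _ g hg
      -- The maps that lift against the single morphism `f` form a class containing every J_s, hence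
      -- also their supremum.
      have : genJS R S ≤ (MorphismProperty.llp (MorphismProperty.ofHoms fun _ : Unit => f)) :=
        iSup₂_le fun s hs _ _ g hg => by
          rintro _ _ _ ⟨⟩
          exact h s hs g hg
      exact this _ hg _ (.mk ())
  rw [h]
  exact forall₂_congr fun s _ => genJ_rlp_iff f s

theorem genIS_rlp_iff {X Y : FilteredComplex R} (f : X ⟶ Y) (r : ℕ) (S : Set ℕ) :
    (genIS R r S).rlp f ↔ BoundaryLifting f r ∧ cycleSurjections R S f := by
  change (genI R r ⊔ genJS R S).rlp f ↔ _
  rw [rlp_sup, genJS_rlp, ← genI_rlp_iff]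
  rfl

/-! ### Weak equivalences in terms of elements -/

theorem mem_Z_iff {A : FilteredComplex R} {s : ℕ} {p n m : ℤ} (h : n + 1 = m) {x : A.cx.X n} :
    x ∈ A.Z s p n ↔ x ∈ A.F p n ∧ A.diff n m x ∈ A.F (p - s) m := by
  subst h
  rfl

theorem mem_B_succ {A : FilteredComplex R} {r : ℕ} {p n : ℤ} {x : A.cx.X n} :
    x ∈ A.B (r + 1) p n ↔ ∃ y ∈ A.Z r (p + r) (n - 1), ∃ z ∈ A.Z r (p - 1) n,
      A.diff (n - 1) n y + z = x := by
  change x ∈ (A.Z r (p + r) (n - 1)).map (A.diff (n - 1) n) ⊔ A.Z r (p - 1) n ↔ _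
  simp [Submodule.mem_sup]

theorem Z_le_Z (A : FilteredComplex R) {s t : ℕ} {p q : ℤ} (h : p ≤ q) (h' : p - s ≤ q - t)
    (n : ℤ) : A.Z s p n ≤ A.Z t q n :=
  fun _ hx => ⟨A.F_le_of_le h n hx.1, A.F_le_of_le h' _ hx.2⟩

theorem diff_mem_Z {A : FilteredComplex R} {s t : ℕ} {p q n m : ℤ} (hm : n + 1 = m)
    {x : A.cx.X n} (hx : x ∈ A.Z s p n) (h : p - s ≤ q) : A.diff n m x ∈ A.Z t q m := by
  refine mem_Z.2 ⟨A.F_le_of_le h m ((mem_Z_iff hm).1 hx).2, ?_⟩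
  rw [diff_diff]
  exact Submodule.zero_mem _

theorem mem_Z_succ_of_diff_mem {A : FilteredComplex R} {r : ℕ} {p q n m : ℤ} (hm : n + 1 = m)
    {x : A.cx.X n} (hx : x ∈ A.Z r p n) (h : A.diff n m x ∈ A.F q m) (hq : q ≤ p - (r + 1 : ℕ)) :
    x ∈ A.Z (r + 1) p n :=
  (mem_Z_iff hm).2 ⟨hx.1, A.F_le_of_le hq m h⟩

theorem E_mk_eq_zero {A : FilteredComplex R} {r : ℕ} {p n : ℤ} (x : A.Z r p n) :
    (Submodule.Quotient.mk x : A.E r p n) = 0 ↔ x.1 ∈ A.B r p n :=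
  Submodule.Quotient.mk_eq_zero _

theorem mapE_mk {X Y : FilteredComplex R} (f : X ⟶ Y) (r : ℕ) (p n : ℤ) (x : X.Z r p n) :
    mapE f r p n (Submodule.Quotient.mk x) = Submodule.Quotient.mk (mapZ f r p n x) := rfl

theorem E_mk_eq_mk {A : FilteredComplex R} {r : ℕ} {p n : ℤ} (x y : A.Z r p n) :
    (Submodule.Quotient.mk x : A.E r p n) = Submodule.Quotient.mk y ↔
      x.1 - y.1 ∈ A.B r p n :=
  Submodule.Quotient.eq _

theorem injective_mapE_iff {X Y : FilteredComplex R} (f : X ⟶ Y) (r : ℕ) (p n : ℤ) :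
    Function.Injective (mapE f r p n) ↔
      ∀ x ∈ X.Z r p n, Hom.app f n x ∈ Y.B r p n → x ∈ X.B r p n := by
  rw [injective_iff_map_eq_zero]
  constructor
  · intro h x hx hfx
    exact (E_mk_eq_zero _).1 (h (Submodule.Quotient.mk ⟨x, hx⟩) ((E_mk_eq_zero _).2 hfx))
  · intro h a ha
    obtain ⟨x, rfl⟩ := Submodule.Quotient.mk_surjective _ a
    rw [mapE_mk, E_mk_eq_zero] at ha
    exact (E_mk_eq_zero _).2 (h x.1 x.2 ha)

theorem surjective_mapE_iff {X Y : FilteredComplex R} (f : X ⟶ Y) (r : ℕ) (p n : ℤ) :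
    Function.Surjective (mapE f r p n) ↔
      ∀ y ∈ Y.Z r p n, ∃ x ∈ X.Z r p n, y - Hom.app f n x ∈ Y.B r p n := by
  constructor
  · intro h y hy
    obtain ⟨a, ha⟩ := h (Submodule.Quotient.mk ⟨y, hy⟩)
    obtain ⟨x, rfl⟩ := Submodule.Quotient.mk_surjective _ a
    exact ⟨x.1, x.2, (E_mk_eq_mk _ _).1 ha.symm⟩
  · intro h b
    obtain ⟨y, rfl⟩ := Submodule.Quotient.mk_surjective _ b
    obtain ⟨x, hx, hxy⟩ := h y.1 y.2
    exact ⟨Submodule.Quotient.mk ⟨x, hx⟩, ((E_mk_eq_mk _ _).2 hxy).symm⟩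

theorem surjective_mapZ_iff {X Y : FilteredComplex R} (f : X ⟶ Y) (s : ℕ) (p n : ℤ) :
    Function.Surjective (mapZ f s p n) ↔
      ∀ y ∈ Y.Z s p n, ∃ x ∈ X.Z s p n, Hom.app f n x = y := by
  constructor
  · intro h y hy
    obtain ⟨x, hx⟩ := h ⟨y, hy⟩
    exact ⟨x.1, x.2, congrArg Subtype.val hx⟩
  · rintro h ⟨y, hy⟩
    obtain ⟨x, hx, hxy⟩ := h y hy
    exact ⟨⟨x, hx⟩, Subtype.ext hxy⟩

theorem mapE_comp {X Y Z : FilteredComplex R} (f : X ⟶ Y) (g : Y ⟶ Z) (r : ℕ) (p n : ℤ) :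
    ⇑(mapE (f ≫ g) r p n) = mapE g r p n ∘ mapE f r p n := by
  funext a
  obtain ⟨x, rfl⟩ := Submodule.Quotient.mk_surjective _ a
  rfl

theorem mapE_id (X : FilteredComplex R) (r : ℕ) (p n : ℤ) : ⇑(mapE (𝟙 X) r p n) = id := by
  funext a
  obtain ⟨x, rfl⟩ := Submodule.Quotient.mk_surjective _ a
  rfl

instance (r : ℕ) : (quasiIsos R r).HasTwoOutOfThreeProperty where
  comp_mem f g hf hg p n := by
    rw [mapE_comp]
    exact (hg p n).comp (hf p n)
  of_postcomp f g hg hfg p n := by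
    have h := hfg p n
    rw [mapE_comp] at h
    exact (Function.Bijective.of_comp_iff' (hg p n) _).1 h
  of_precomp f g hf hfg p n := by
    have h := hfg p n
    rw [mapE_comp] at h
    exact (Function.Bijective.of_comp_iff _ (hf p n)).1 h

/-! ### Trivial fibrations -/

section

variable {X Y : FilteredComplex R} {f : X ⟶ Y} {r : ℕ}

theorem exists_mem_B_of_mem_B (hZ : ∀ p n, Function.Surjective (mapZ f r p n)) {p n : ℤ}
    {b : Y.cx.X n} (hb : b ∈ Y.B (r + 1) p n) : ∃ x ∈ X.B (r + 1) p n, Hom.app f n x = b := by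
  obtain ⟨y, hy, z, hz, rfl⟩ := mem_B_succ.1 hb
  obtain ⟨v, hv, rfl⟩ := (surjective_mapZ_iff f r _ _).1 (hZ _ _) y hy
  obtain ⟨w, hw, rfl⟩ := (surjective_mapZ_iff f r _ _).1 (hZ _ _) z hz
  exact ⟨_, mem_B_succ.2 ⟨v, hv, w, hw, rfl⟩, by rw [map_add, app_diff]⟩

/-- Lift the class in E_{r+1} first. The error lies in B_{r+1}, which is built from r-cycles and
therefore lifts too. -/
theorem surjective_mapZ_succ (hZ : ∀ p n, Function.Surjective (mapZ f r p n))
    (hE : ∀ p n, Function.Surjective (mapE f (r + 1) p n)) (p n : ℤ) :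
    Function.Surjective (mapZ f (r + 1) p n) := by
  refine (surjective_mapZ_iff f _ _ _).2 fun y hy => ?_
  obtain ⟨x, hx, hxy⟩ := (surjective_mapE_iff f _ _ _).1 (hE p n) y hy
  obtain ⟨b, hb, hby⟩ := exists_mem_B_of_mem_B hZ hxy
  exact ⟨x + b, add_mem hx (X.B_le_Z _ _ _ hb), by rw [map_add, hby, add_sub_cancel]⟩

/-- Injectivity on E_{r+1} gives some x = dv + w, but v and w need not lie above y and z. The defect
y - f v is an (r+1)-cycle, so it lifts to some t, and (v + t, w - dt) is the corrected pair. -/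
theorem boundaryLifting_of_quasiIso (hZ : ∀ p n, Function.Surjective (mapZ f r p n))
    (hE : quasiIsos R r f) : BoundaryLifting f r := by
  intro p n x hx y hy z hz hxyz
  have hZ' := fun p n => (surjective_mapZ_iff f r p n).1 (hZ p n)
  obtain ⟨v, hv, w, hw, hvw⟩ := mem_B_succ.1 ((injective_mapE_iff f _ _ _).1 (hE p n).1 x hx
    (by rw [hxyz]; exact mem_B_succ.2 ⟨y, hy, z, hz, rfl⟩))
  have hu : y - Hom.app f (n - 1) v ∈ Y.Z r (p + r) (n - 1) := sub_mem hy (map_mem_Z f r _ _ v hv)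
  have hdu : Y.diff (n - 1) n (y - Hom.app f (n - 1) v) = Hom.app f n w - z := by
    rw [map_sub, ← app_diff, sub_eq_sub_iff_add_eq_add, ← hxyz, ← hvw, map_add]
    abel
  -- The differential f w - z of the defect lies in F_{p-1}, and p - 1 = (p + r) - (r + 1).
  have hu' : y - Hom.app f (n - 1) v ∈ Y.Z (r + 1) (p + r) (n - 1) :=
    mem_Z_succ_of_diff_mem (q := p - 1) (m := n) (by omega) hu
      (by rw [hdu]; exact sub_mem (map_mem_Z f r _ _ w hw).1 hz.1) (by push_cast; omega)
  obtain ⟨t, ht, htu⟩ := (surjective_mapZ_iff f _ _ _).1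
    (surjective_mapZ_succ hZ (fun p n => (hE p n).2) _ _) _ hu'
  refine ⟨v + t, add_mem hv (X.Z_le_Z le_rfl (by push_cast; omega) _ ht), w - X.diff (n - 1) n t,
    sub_mem hw (diff_mem_Z (by omega) ht (by push_cast; omega)), ?_, ?_, ?_⟩
  · rw [map_add, ← hvw]
    abel
  · rw [map_add, htu, add_sub_cancel]
  · rw [map_sub, app_diff, htu, hdu, sub_sub_cancel]

theorem quasiIso_of_boundaryLifting (h : BoundaryLifting f r) : quasiIsos R r f := by
  refine fun p n => ⟨(injective_mapE_iff f _ _ _).2 fun x hx hfx => ?_,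
    (surjective_mapE_iff f _ _ _).2 fun y hy => ?_⟩
  · obtain ⟨y, hy, z, hz, hyz⟩ := mem_B_succ.1 hfx
    obtain ⟨v, hv, w, hw, hvw, -, -⟩ := h p n x hx y hy z hz hyz.symm
    exact mem_B_succ.2 ⟨v, hv, w, hw, hvw⟩
  · obtain ⟨m, rfl⟩ : ∃ m, n = m - 1 := ⟨n + 1, by omega⟩
    obtain ⟨q, rfl⟩ : ∃ q : ℤ, p = q + r := ⟨p - r, by omega⟩
    obtain ⟨v, hv, w, hw, hvw, hfv, -⟩ := h q m 0 (Submodule.zero_mem _) y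
      (Y.Z_le_Z le_rfl (by push_cast; omega) _ hy) (-Y.diff (m - 1) m y)
      (neg_mem (diff_mem_Z (by omega) hy (by push_cast; omega))) (by rw [map_zero, add_neg_cancel])
    -- Since dv = -w lies in F_{q-1}, the r-cycle v is an (r+1)-cycle.
    refine ⟨v, mem_Z_succ_of_diff_mem (q := q - 1) (m := m) (by omega) hv ?_ (by push_cast; omega), ?_⟩
    · rw [eq_neg_of_add_eq_zero_left hvw]
      exact neg_mem hw.1
    · rw [hfv, sub_self]
      exact Submodule.zero_mem _

end

theorem genIS_rlp (r : ℕ) (S : Set ℕ) (hr : r ∈ S) :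
    (genIS R r S).rlp = cycleSurjections R S ⊓ quasiIsos R r := by
  ext X Y f
  rw [genIS_rlp_iff]
  exact ⟨fun h => ⟨h.2, quasiIso_of_boundaryLifting h.1⟩,
    fun h => ⟨boundaryLifting_of_quasiIso (h.1 r hr) h.2, h.1⟩⟩

/-! ### Right properness -/

/-- As a representable functor, Z_s preserves pullbacks; this is the existence half, and
`eq_of_isPullback` is the uniqueness half. -/
theorem exists_mem_Z_of_isPullback {P X Y Z : FilteredComplex R} {a : P ⟶ X} {b : P ⟶ Y}
    {f : X ⟶ Z} {g : Y ⟶ Z} (h : IsPullback a b f g) {s : ℕ} {p n : ℤ} {x : X.cx.X n}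
    {y : Y.cx.X n} (hx : x ∈ X.Z s p n) (hy : y ∈ Y.Z s p n)
    (hxy : Hom.app f n x = Hom.app g n y) :
    ∃ w ∈ P.Z s p n, Hom.app a n w = x ∧ Hom.app b n w = y := by
  have e : ofZ X x hx ≫ f = ofZ Y y hy ≫ g := repZ_hom_ext (by
    rw [comp_app, comp_app, ofZ_gen, ofZ_gen, hxy])
  refine ⟨_, app_gen_mem_Z (h.lift _ _ e), ?_, ?_⟩
  · rw [← comp_app, h.lift_fst, ofZ_gen]
  · rw [← comp_app, h.lift_snd, ofZ_gen]

theorem eq_of_isPullback {P X Y Z : FilteredComplex R} {a : P ⟶ X} {b : P ⟶ Y}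
    {f : X ⟶ Z} {g : Y ⟶ Z} (h : IsPullback a b f g) {s : ℕ} {p n : ℤ} {v w : P.cx.X n}
    (hv : v ∈ P.Z s p n) (hw : w ∈ P.Z s p n) (h₁ : Hom.app a n v = Hom.app a n w)
    (h₂ : Hom.app b n v = Hom.app b n w) : v = w := by
  have e : ofZ P v hv = ofZ P w hw := h.hom_ext
    (repZ_hom_ext (by rw [comp_app, comp_app, ofZ_gen, ofZ_gen, h₁]))
    (repZ_hom_ext (by rw [comp_app, comp_app, ofZ_gen, ofZ_gen, h₂]))
  rw [← ofZ_gen P v hv, e, ofZ_gen]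

theorem quasiIso_of_isPullback {P X Y Z : FilteredComplex R} {a : P ⟶ X} {b : P ⟶ Y}
    {f : X ⟶ Z} {g : Y ⟶ Z} (h : IsPullback a b f g) {r : ℕ} (hf : quasiIsos R r f)
    (hg : ∀ p n, Function.Surjective (mapZ g r p n)) : quasiIsos R r b := by
  have hw := fun n (w : P.cx.X n) => app_eq_of_comp_eq h.w n w
  refine fun p n => ⟨(injective_mapE_iff b _ _ _).2 fun w hwZ hbw => ?_,
    (surjective_mapE_iff b _ _ _).2 fun y hy => ?_⟩
  · obtain ⟨y₁, hy₁, y₂, hy₂, hy⟩ := mem_B_succ.1 hbw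
    obtain ⟨x₁, hx₁, x₂, hx₂, hx⟩ := mem_B_succ.1 ((injective_mapE_iff f _ _ _).1 (hf p n).1 _
      (map_mem_Z a _ _ _ w hwZ) (by rw [hw]; exact map_mem_B g _ _ _ _ hbw))
    have hfg : Hom.app f n (X.diff (n - 1) n x₁ + x₂) =
        Hom.app g n (Y.diff (n - 1) n y₁ + y₂) := by
      rw [hx, hy, hw]
    rw [map_add, map_add, app_diff, app_diff] at hfg
    -- Both projections of w are boundaries, but their presentations (x₁, x₂) and (y₁, y₂) may
    -- disagree in Z. The discrepancy u = f x₁ - g y₁ is an (r+1)-cycle, because du = g y₂ - f x₂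
    -- lies in F_{p-1}.
    have hu : Hom.app f (n - 1) x₁ - Hom.app g (n - 1) y₁ ∈ Z.Z r (p + r) (n - 1) :=
      sub_mem (map_mem_Z f r _ _ _ hx₁) (map_mem_Z g r _ _ _ hy₁)
    have hdu : Z.diff (n - 1) n (Hom.app f (n - 1) x₁ - Hom.app g (n - 1) y₁) =
        Hom.app g n y₂ - Hom.app f n x₂ := by
      rw [map_sub, sub_eq_sub_iff_add_eq_add, hfg, add_comm]
    have hu' := mem_Z_succ_of_diff_mem (q := p - 1) (m := n) (by omega) hu
      (by rw [hdu]; exact sub_mem (map_mem_Z g r _ _ _ hy₂).1 (map_mem_Z f r _ _ _ hx₂).1)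
      (by push_cast; omega)
    -- Write u = f x₃ + g y₃, with y₃ a boundary. Replacing x₁, y₁ by x₁ - x₃, y₁ + y₃ and x₂, y₂ by
    -- x₂ + dx₃, y₂ - dy₃ keeps both sums and makes the presentations compatible.
    obtain ⟨x₃, hx₃, hb⟩ := (surjective_mapE_iff f _ _ _).1 (hf _ _).2 _ hu'
    obtain ⟨y₃, hy₃, hy₃'⟩ := exists_mem_B_of_mem_B hg hb
    have hy₃ := Y.B_le_Z _ _ _ hy₃
    have key : Hom.app f (n - 1) (x₁ - x₃) = Hom.app g (n - 1) (y₁ + y₃) := by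
      rw [map_sub, map_add, hy₃']
      abel
    obtain ⟨v, hv, hva, hvb⟩ := exists_mem_Z_of_isPullback h (s := r) (p := p + r)
      (sub_mem hx₁ (X.Z_le_Z le_rfl (by push_cast; omega) _ hx₃))
      (add_mem hy₁ (Y.Z_le_Z le_rfl (by push_cast; omega) _ hy₃)) key
    obtain ⟨v', hv', hva', hvb'⟩ := exists_mem_Z_of_isPullback h (s := r) (p := p - 1)
      (x := x₂ + X.diff (n - 1) n x₃) (y := y₂ - Y.diff (n - 1) n y₃)
      (add_mem hx₂ (diff_mem_Z (by omega) hx₃ (by push_cast; omega)))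
      (sub_mem hy₂ (diff_mem_Z (by omega) hy₃ (by push_cast; omega))) (by
        -- Subtracting the differential of `key` from `hfg` leaves the equality of the second
        -- components.
        have := congrArg (Z.diff (n - 1) n) key
        rw [← app_diff, ← app_diff, map_sub, map_add, map_sub, map_add, app_diff f, app_diff g]
          at this
        rw [map_add, map_sub]
        rw [← sub_eq_zero] at this hfg ⊢
        rw [← sub_eq_zero.2 (hfg.trans this.symm)]
        abel)
    refine mem_B_succ.2 ⟨v, hv, v', hv', ?_⟩
    refine eq_of_isPullback h (s := r + 1) (p := p) ?_ hwZ ?_ ?_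
    · exact P.B_le_Z _ _ _ (mem_B_succ.2 ⟨v, hv, v', hv', rfl⟩)
    · rw [map_add, app_diff, hva, hva', ← hx, map_sub]
      abel
    · rw [map_add, app_diff, hvb, hvb', ← hy, map_add]
      abel
  · obtain ⟨x, hx, hb⟩ := (surjective_mapE_iff f _ _ _).1 (hf p n).2 _ (map_mem_Z g _ _ _ y hy)
    obtain ⟨y', hy', hyb⟩ := exists_mem_B_of_mem_B hg hb
    obtain ⟨w, hwZ, -, hwb⟩ := exists_mem_Z_of_isPullback h hx
      (sub_mem hy (Y.B_le_Z _ _ _ hy')) (by rw [map_sub, hyb, sub_sub_cancel])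
    exact ⟨w, hwZ, by rwa [hwb, sub_sub_cancel]⟩

/-! ### The path object -/

open Classical in
/-- The identification of `A^i` with `A^j` if `i = j`, and zero otherwise. -/
noncomputable def transport (A : FilteredComplex R) (i j : ℤ) : A.cx.X i →ₗ[R] A.cx.X j :=
  if h : i = j then (eqToHom (congrArg A.cx.X h)).hom else 0

@[simp]
theorem transport_self (A : FilteredComplex R) (i : ℤ) (x : A.cx.X i) :
    A.transport i i x = x := by
  simp [transport]

theorem transport_of_ne (A : FilteredComplex R) {i j : ℤ} (h : i ≠ j) : A.transport i j = 0 :=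
  dif_neg h

/-- Degrees such as i and i + 1 - 1 are equal only propositionally; this moves the differential
across such equalities. -/
theorem transport_diff (A : FilteredComplex R) {i i' j j' : ℤ} (hi : i = i') (hj : j = j')
    (x : A.cx.X i) : A.transport j j' (A.diff i j x) = A.diff i' j' (A.transport i i' x) := by
  subst hi hj
  simp

theorem transport_transport (A : FilteredComplex R) {i j : ℤ} (h : i = j) (x : A.cx.X i) :
    A.transport j i (A.transport i j x) = x := by
  subst h
  simp

theorem transport_mem_F (A : FilteredComplex R) {p i j : ℤ} {x : A.cx.X i} (hx : x ∈ A.F p i) :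
    A.transport i j x ∈ A.F p j := by
  by_cases h : i = j
  · subst h
    simpa
  · rw [transport_of_ne _ h]
    exact Submodule.zero_mem _

/-- The differential of the path object. -/
noncomputable def pathDiff (A : FilteredComplex R) (i j : ℤ) :
    (A.cx.X i × A.cx.X i × A.cx.X (i - 1)) →ₗ[R] (A.cx.X j × A.cx.X j × A.cx.X (j - 1)) :=
  let a := LinearMap.fst R (A.cx.X i) (A.cx.X i × A.cx.X (i - 1))
  let b := LinearMap.fst R _ _ ∘ₗ LinearMap.snd R (A.cx.X i) (A.cx.X i × A.cx.X (i - 1))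
  let c := LinearMap.snd R _ _ ∘ₗ LinearMap.snd R (A.cx.X i) (A.cx.X i × A.cx.X (i - 1))
  (A.diff i j ∘ₗ a).prod ((A.diff i j ∘ₗ b).prod
    (A.transport i (j - 1) ∘ₗ (a - b) - A.diff (i - 1) (j - 1) ∘ₗ c))

theorem pathDiff_apply (A : FilteredComplex R) (i j : ℤ)
    (x : A.cx.X i × A.cx.X i × A.cx.X (i - 1)) :
    A.pathDiff i j x = (A.diff i j x.1, A.diff i j x.2.1,
      A.transport i (j - 1) (x.1 - x.2.1) - A.diff (i - 1) (j - 1) x.2.2) := rfl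

/-- The `r`-path object of `A`: in degree `n` it is `A^n ⊕ A^n ⊕ A^{n-1}`, with differential
`(a, b, c) ↦ (da, db, a - b - dc)`, where the filtration of the last summand is shifted by `r`. -/
noncomputable def path (A : FilteredComplex R) (r : ℕ) : FilteredComplex R where
  cx :=
    { X n := ModuleCat.of R (A.cx.X n × A.cx.X n × A.cx.X (n - 1))
      d i j := ModuleCat.ofHom (A.pathDiff i j)
      shape i j hij := by
        have hij' : i + 1 ≠ j := hij
        refine ModuleCat.hom_ext (LinearMap.ext fun x => ?_)
        change A.pathDiff i j x = 0
        rw [pathDiff_apply, transport_of_ne _ (by omega), diff, A.cx.shape i j hij, diff,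
          A.cx.shape _ _ (show ¬ i - 1 + 1 = j - 1 by omega)]
        exact Prod.ext rfl (Prod.ext rfl (sub_zero _))
      d_comp_d' i j k hij hjk := by
        obtain rfl : i + 1 = j := hij
        obtain rfl : i + 1 + 1 = k := hjk
        refine ModuleCat.hom_ext (LinearMap.ext fun x => ?_)
        change A.pathDiff _ _ (A.pathDiff _ _ x) = 0
        -- In the last summand, the term d(a - b) arises twice with opposite signs, thanks to the
        -- minus sign in a - b - dc.
        simp only [pathDiff_apply, diff_diff, ← map_sub]
        rw [transport_diff A (show i = i + 1 - 1 by omega) (by omega)]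
        simp only [map_sub, diff_diff, sub_zero, sub_self]
        rfl }
  F p n := (A.F p n).prod ((A.F p n).prod (A.F (p + r) (n - 1)))
  F_mono p n := Submodule.prod_mono (A.F_mono p n) (Submodule.prod_mono (A.F_mono p n)
    (A.F_le_of_le (by omega) _))
  F_d p i j x hx := ⟨A.F_d p i j _ hx.1, A.F_d p i j _ hx.2.1,
    sub_mem (A.F_le_of_le (by omega) _ (A.transport_mem_F (sub_mem hx.1 hx.2.1)))
      (A.F_d (p + r) _ _ _ hx.2.2)⟩

/-- The constant paths. -/
noncomputable def pathConst (A : FilteredComplex R) (r : ℕ) : A ⟶ A.path r where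
  f :=
    { f n := ModuleCat.ofHom (LinearMap.id.prod (LinearMap.id.prod 0))
      comm' i j _ := by
        refine ModuleCat.hom_ext (LinearMap.ext fun x => ?_)
        change A.pathDiff i j (x, x, 0) = (A.diff i j x, A.diff i j x, 0)
        rw [pathDiff_apply, sub_self, map_zero, map_zero, sub_zero] }
  map_F _ _ _ hx := ⟨hx, hx, Submodule.zero_mem _⟩

/-- The endpoints of a path. -/
noncomputable def pathEnds (A : FilteredComplex R) (r : ℕ) : A.path r ⟶ A.sum A where
  f :=
    { f n := ModuleCat.ofHom ((LinearMap.fst R (A.cx.X n) (A.cx.X n × A.cx.X (n - 1))).prod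
        (LinearMap.fst R _ _ ∘ₗ LinearMap.snd R (A.cx.X n) (A.cx.X n × A.cx.X (n - 1))))
      comm' _ _ _ := rfl }
  map_F _ _ _ hx := ⟨hx.1, hx.2.1⟩

/-- The first projection. -/
def sumFst (A A' : FilteredComplex R) : A.sum A' ⟶ A where
  f :=
    { f i := ModuleCat.ofHom (LinearMap.fst R (A.cx.X i) (A'.cx.X i))
      comm' _ _ _ := rfl }
  map_F _ _ _ hx := hx.1

/-- The second projection. -/
def sumSnd (A A' : FilteredComplex R) : A.sum A' ⟶ A' where
  f :=
    { f i := ModuleCat.ofHom (LinearMap.snd R (A.cx.X i) (A'.cx.X i))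
      comm' _ _ _ := rfl }
  map_F _ _ _ hx := hx.2

/-- The morphism to a direct sum given by morphisms to both summands. -/
def sumLift {A A' C : FilteredComplex R} (f : C ⟶ A) (g : C ⟶ A') : C ⟶ A.sum A' where
  f :=
    { f i := ModuleCat.ofHom ((Hom.app f i).prod (Hom.app g i))
      comm' i j _ := by
        refine ModuleCat.hom_ext (LinearMap.ext fun a => ?_)
        exact Prod.ext (app_diff f i j a).symm (app_diff g i j a).symm }
  map_F p n x hx := ⟨f.map_F p n _ hx, g.map_F p n _ hx⟩

/-- An s-cycle (a, b) lifts to (a, b, 0): the new component a - b of the differential lies in F_p,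
hence in F_{p-s+r} because s ≤ r. This is where the bound on S enters. -/
theorem pathEnds_mem_cycleSurjections (A : FilteredComplex R) {r : ℕ} {S : Set ℕ}
    (hS : S ⊆ Set.Iic r) : cycleSurjections R S (A.pathEnds r) := by
  intro s hs p n
  have hsr : s ≤ r := hS hs
  rintro ⟨x, hx⟩
  refine ⟨⟨(x.1, x.2, 0), ⟨⟨hx.1.1, hx.1.2, Submodule.zero_mem _⟩, ?_⟩⟩, rfl⟩
  refine ⟨hx.2.1, hx.2.2, ?_⟩
  change A.transport n (n + 1 - 1) (x.1 - x.2) - A.diff (n - 1) (n + 1 - 1) 0 ∈ A.F (p - s + r) _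
  rw [map_zero, sub_zero]
  exact A.F_le_of_le (by omega) _ (A.transport_mem_F (sub_mem hx.1.1 hx.1.2))

/-- For an (r+1)-cycle (a, b, c) of the path object, the shift by r puts c in F_{p+r} and a - b - dc
in F_{p-1}. So a - b = dc + (a - b - dc) has exactly the form of an element of B_{r+1}. -/
theorem mapE_pathEnds_fst_eq_snd (A : FilteredComplex R) (r : ℕ) (p n : ℤ) :
    ⇑(mapE (A.pathEnds r ≫ sumFst A A) (r + 1) p n) =
      mapE (A.pathEnds r ≫ sumSnd A A) (r + 1) p n := by
  funext w
  obtain ⟨⟨w, hw⟩, rfl⟩ := Submodule.Quotient.mk_surjective _ w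
  refine (E_mk_eq_mk _ _).2 ?_
  obtain ⟨a, b, c⟩ := w
  obtain ⟨⟨ha, hb, hc⟩, hda, hdb, hdc⟩ := hw
  change a - b ∈ A.B (r + 1) p n
  change A.diff n (n + 1) a ∈ A.F (p - (r + 1 : ℕ)) (n + 1) at hda
  change A.diff n (n + 1) b ∈ A.F (p - (r + 1 : ℕ)) (n + 1) at hdb
  have hz : a - b - A.diff (n - 1) n c ∈ A.F (p - 1) n := by
    have h : A.transport (n + 1 - 1) n (A.transport n (n + 1 - 1) (a - b) -
        A.diff (n - 1) (n + 1 - 1) c) ∈ A.F (p - (r + 1 : ℕ) + r) n := A.transport_mem_F hdc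
    rw [map_sub, transport_transport _ (by omega), transport_diff A rfl (by omega),
      transport_self] at h
    exact A.F_le_of_le (by push_cast; omega) n h
  have hab : a - b ∈ A.F p n := sub_mem ha hb
  refine mem_B_succ.2 ⟨c, (mem_Z_iff (m := n) (by omega)).2 ⟨hc, ?_⟩, a - b - A.diff (n - 1) n c,
    mem_Z.2 ⟨hz, ?_⟩, add_sub_cancel _ _⟩
  · have := sub_mem hab (A.F_le_of_le (show p - 1 ≤ p by omega) n hz)
    rw [sub_sub_cancel] at this
    exact A.F_le_of_le (by omega) n this
  · rw [map_sub, diff_diff, sub_zero, map_sub]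
    exact A.F_le_of_le (by push_cast; omega) _ (sub_mem hda hdb)

/-- Lifting against the fibration A ⟶ 0 gives a retraction g of f; lifting against the endpoints of
the path object of B gives a homotopy from the composite B ⟶ A ⟶ B to the identity. Hence g inverts
f on E_{r+1}. -/
theorem quasiIso_of_llp {r : ℕ} {S : Set ℕ} (hS : S ⊆ Set.Iic r) {A B : FilteredComplex R}
    (f : A ⟶ B) (hf : (cycleSurjections R S).llp f) : quasiIsos R r f := by
  have h₀ : HasLiftingProperty f (toZero A) := hf _ fun s _ p n y =>
    ⟨0, Subtype.ext rfl⟩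
  have sq₀ : CommSq (𝟙 A) f (toZero A) (toZero B) := ⟨rfl⟩
  have h₁ := hf _ (pathEnds_mem_cycleSurjections B hS)
  have hg : f ≫ sq₀.lift = 𝟙 A := sq₀.fac_left
  have sq₁ : CommSq (f ≫ B.pathConst r) f (B.pathEnds r) (sumLift (sq₀.lift ≫ f) (𝟙 B)) := by
    refine ⟨hom_ext fun n x => Prod.ext ?_ rfl⟩
    change Hom.app f n x = Hom.app f n (Hom.app sq₀.lift n (Hom.app f n x))
    rw [← comp_app f sq₀.lift, hg]
    rfl
  have e₁ : sq₁.lift ≫ B.pathEnds r ≫ sumFst B B = sq₀.lift ≫ f := by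
    rw [← Category.assoc, sq₁.fac_right]
    rfl
  have e₂ : sq₁.lift ≫ B.pathEnds r ≫ sumSnd B B = 𝟙 B := by
    rw [← Category.assoc, sq₁.fac_right]
    rfl
  intro p n
  refine Function.bijective_iff_has_inverse.2 ⟨mapE sq₀.lift (r + 1) p n, fun a => ?_, fun b => ?_⟩
  · rw [← Function.comp_apply (f := mapE _ _ _ _), ← mapE_comp, hg, mapE_id, id]
  · rw [← Function.comp_apply (f := mapE _ _ _ _), ← mapE_comp, ← e₁, mapE_comp,
      mapE_pathEnds_fst_eq_snd, ← mapE_comp, e₂, mapE_id, id]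

open HomotopicalAlgebra MorphismProperty

/-! ### The model structure -/

theorem hasSmallObjectArgument_of_finPres (I : MorphismProperty (FilteredComplex R))
    [IsSmall.{u} I] (hI : ∀ ⦃A B : FilteredComplex R⦄ (i : A ⟶ B), I i → FinPres A) :
    HasSmallObjectArgument.{u} I := by
  have : Fact Cardinal.aleph0.{u}.IsRegular := Cardinal.fact_isRegular_aleph0
  have hb : OrderBot Cardinal.aleph0.{u}.ord.ToType := Cardinal.orderBotAleph0OrdToType
  refine ⟨Cardinal.aleph0.{u}, inferInstance, hb, ?_⟩
  exact { preservesColimit := fun i hi f hf => (hI i hi).preservesColimit hf.F }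

instance (s : ℕ) : IsSmall.{u} (genJ R s) := by
  unfold genJ
  have : Small.{u} (ℤ × ℤ) := Countable.toSmall _
  infer_instance

instance (r : ℕ) : IsSmall.{u} (genI R r) := by
  unfold genI
  have : Small.{u} (ℤ × ℤ) := Countable.toSmall _
  infer_instance

instance (S : Set ℕ) : IsSmall.{u} (genJS R S) := by
  have : genJS R S = ⨆ s : S, genJ R s := iSup_subtype'
  rw [this]
  infer_instance

theorem isSmall_sup {C : Type*} [Category* C] (W W' : MorphismProperty C) [IsSmall.{w} W]
    [IsSmall.{w} W'] : IsSmall.{w} (W ⊔ W') := by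
  rw [sup_eq_iSup]
  have (b : Bool) : IsSmall.{w} (cond b W W') := by cases b <;> assumption
  infer_instance

instance (r : ℕ) (S : Set ℕ) : IsSmall.{u} (genIS R r S) :=
  isSmall_sup (genI R r) (genJS R S)

theorem finPres_of_genJS {S : Set ℕ} ⦃A B : FilteredComplex R⦄ (i : A ⟶ B) (hi : genJS R S i) :
    FinPres A ∧ FinPres B := by
  have h : genJS R S ≤ fun A B _ => FinPres A ∧ FinPres B := iSup₂_le fun s _ => by
    rintro _ _ _ ⟨p, n⟩
    exact ⟨finPres_zeroObj, finPres_repZ s p n⟩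
  exact h i hi

theorem finPres_of_genIS {r : ℕ} {S : Set ℕ} ⦃A B : FilteredComplex R⦄ (i : A ⟶ B)
    (hi : genIS R r S i) : FinPres A ∧ FinPres B := by
  have h : genI R r ⊔ genJS R S ≤ fun A B _ => FinPres A ∧ FinPres B := by
    refine sup_le ?_ finPres_of_genJS
    rintro _ _ _ ⟨p, n⟩
    exact ⟨finPres_repZ _ p n, (finPres_repZ _ _ _).sum (finPres_repZ _ _ _)⟩
  exact h i hi

instance (S : Set ℕ) : HasSmallObjectArgument.{u} (genJS R S) :=
  hasSmallObjectArgument_of_finPres _ fun _ _ i hi => (finPres_of_genJS i hi).1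

instance (r : ℕ) (S : Set ℕ) : HasSmallObjectArgument.{u} (genIS R r S) :=
  hasSmallObjectArgument_of_finPres _ fun _ _ i hi => (finPres_of_genIS i hi).1

/-- The retract argument: factor an acyclic cofibration through J_S. By two-out-of-three the second
factor is an acyclic fibration, so f lifts against it and is a retract of the first factor. -/
theorem llp_cycleSurjections {r : ℕ} {S : Set ℕ} (hS : S ⊆ Set.Iic r) (hr : r ∈ S) :
    (genIS R r S).rlp.llp ⊓ quasiIsos R r = (cycleSurjections R S).llp := by
  refine le_antisymm ?_ fun A B f hf => ⟨?_, quasiIso_of_llp hS f hf⟩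
  · rintro A B f ⟨hf, hw⟩
    let d := factorizationData (genJS R S).rlp.llp (genJS R S).rlp f
    have hi : (cycleSurjections R S).llp d.i := by
      rw [← genJS_rlp]
      exact d.hi
    have hp : cycleSurjections R S d.p := by
      rw [← genJS_rlp]
      exact d.hp
    have hpw : quasiIsos R r d.p :=
      (quasiIsos R r).of_precomp _ _ (quasiIso_of_llp hS _ hi) (by rwa [d.fac])
    have : HasLiftingProperty f d.p := hf _ (by
      rw [genIS_rlp r S hr]
      exact ⟨hp, hpw⟩)
    exact of_retract (RetractArrow.ofLeftLiftingProperty d.fac) hi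
  · refine antitone_llp ?_ f hf
    rw [genIS_rlp r S hr]
    exact inf_le_left

theorem isWeakFactorizationSystem_llp_rlp {C : Type*} [Category* C] (I : MorphismProperty C)
    [HasSmallObjectArgument.{w} I] : IsWeakFactorizationSystem I.rlp.llp I.rlp where
  rlp := rlp_llp_rlp I
  llp := rfl

variable (R) in
/-- The model structure on filtered complexes. -/
@[reducible]
noncomputable def modelCategory (r : ℕ) (S : Set ℕ) (hS : S ⊆ Set.Iic r) (hr : r ∈ S) :
    ModelCategory (FilteredComplex R) :=
  letI : CategoryWithFibrations (FilteredComplex R) := ⟨cycleSurjections R S⟩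
  letI : CategoryWithWeakEquivalences (FilteredComplex R) := ⟨quasiIsos R r⟩
  letI : CategoryWithCofibrations (FilteredComplex R) := ⟨(genIS R r S).rlp.llp⟩
  haveI : (weakEquivalences (FilteredComplex R)).HasTwoOutOfThreeProperty :=
    inferInstanceAs (quasiIsos R r).HasTwoOutOfThreeProperty
  haveI : IsWeakFactorizationSystem (cofibrations (FilteredComplex R))
      (trivialFibrations (FilteredComplex R)) := by
    have h : trivialFibrations (FilteredComplex R) = (genIS R r S).rlp := (genIS_rlp r S hr).symm
    rw [h]
    exact isWeakFactorizationSystem_llp_rlp.{u} (genIS R r S)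
  haveI : IsWeakFactorizationSystem (trivialCofibrations (FilteredComplex R))
      (fibrations (FilteredComplex R)) := by
    have h : trivialCofibrations (FilteredComplex R) = (genJS R S).rlp.llp := by
      rw [genJS_rlp]
      exact llp_cycleSurjections hS hr
    have h' : fibrations (FilteredComplex R) = (genJS R S).rlp := (genJS_rlp S).symm
    rw [h, h']
    exact isWeakFactorizationSystem_llp_rlp.{u} (genJS R S)
  -- Two weak factorization systems and two-out-of-three suffice; closure of the weak equivalences
  -- under retracts is a consequence.
  ModelCategory.mk' _

end FilteredComplex

/-! ### The main theorem -/

theorem mainTheorem2 (R : Type u) [CommRing R] (r : ℕ) (S : Set ℕ) (hS : S ⊆ Set.Iic r)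
    (hr : r ∈ S) :
    ∃ _ : HomotopicalAlgebra.ModelCategory (FilteredComplex R),
      ModelCat.IsCompleteFunctorial (FilteredComplex R) ∧
      HomotopicalAlgebra.weakEquivalences (FilteredComplex R) = FilteredComplex.quasiIsos R r ∧
      HomotopicalAlgebra.fibrations (FilteredComplex R) = FilteredComplex.cycleSurjections R S ∧
      ModelCat.IsRightProper (FilteredComplex R) ∧
      ModelCat.IsFinitelyCofibrantlyGenerated
        (FilteredComplex.genIS R r S) (FilteredComplex.genJS R S) := by
  have hJ := FilteredComplex.genJS_rlp (R := R) S
  have hI := FilteredComplex.genIS_rlp (R := R) r S hr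
  have hJ' := FilteredComplex.llp_cycleSurjections (R := R) hS hr
  rw [← hJ] at hJ'
  let := FilteredComplex.modelCategory R r S hS hr
  refine ⟨this, ?_, rfl, rfl, ?_, ?_⟩
  · refine ⟨inferInstance, inferInstance, ?_, ?_⟩
    · change MorphismProperty.HasFunctorialFactorization
        ((FilteredComplex.genIS R r S).rlp.llp ⊓ FilteredComplex.quasiIsos R r)
        (FilteredComplex.cycleSurjections R S)
      rw [hJ', ← hJ]
      infer_instance
    · change MorphismProperty.HasFunctorialFactorization (FilteredComplex.genIS R r S).rlp.llp
        (FilteredComplex.cycleSurjections R S ⊓ FilteredComplex.quasiIsos R r)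
      rw [← hI]
      infer_instance
  · exact fun P X Y Z a b f g h hf hg => FilteredComplex.quasiIso_of_isPullback h hf (hg r hr)
  · exact
      { isSmall_I := inferInstance
        isSmall_J := inferInstance
        small_I := fun _ _ i hi =>
          (FilteredComplex.finPres_of_genIS i hi).1.isFiniteRel _ |>.imp' _ fun _ h => h
        small_J := fun _ _ i hi =>
          (FilteredComplex.finPres_of_genJS i hi).1.isFiniteRel _ |>.imp' _ fun _ h => h
        fibrations_eq := hJ.symm
        trivialFibrations_eq := hI.symm
        finite_I := fun _ _ i hi =>
          (FilteredComplex.finPres_of_genIS i hi).imp (fun h => h.isFiniteRel _)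
            fun h => h.isFiniteRel _
        finite_J := fun _ _ i hi =>
          (FilteredComplex.finPres_of_genJS i hi).imp (fun h => h.isFiniteRel _)
            fun h => h.isFiniteRel _ }
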